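/- Let $P$ be the set of partitions $\lambda=(\lambda_1\ge\lambda_2\ge\cdots)$, let $m_\lambda$ and $s_\lambda$ ($\lambda\in P$) be the monomial symmetric functions and the Schur functions in infinitely many variables, and let $\Lambda_{\mathbf N}=\bigoplus_{\lambda}\mathbf N\,m_\lambda$ and $\Lambda^{\mathrm{Sch}}=\bigoplus_{\lambda}\mathbf N\,s_\lambda$. These are semirings, and $\Lambda^{\mathrm{Sch}}$ is the subsemiring of $\Lambda_{\mathbf N}$ generated by the Schur functions. For a commutative semiring $A$ put $W(A)=\mathrm{Hom}_{\mathrm{semiring}}(\Lambda_{\mathbf N},A)$ and $W^{\mathrm{Sch}}(A)=\mathrm{Hom}_{\mathrm{semiring}}(\Lambda^{\mathrm{Sch}},A)$; restriction along $\Lambda^{\mathrm{Sch}}\subseteq\Lambda_{\mathbf N}$ is the natural map $W(A)\to W^{\mathrm{Sch}}(A)$. Let $\mathbf B=\{0,1\}$ be the Boolean semiring, in which $1+1=1$. For $x,y\in\mathbf N$ let $(x,y)\in W(\mathbf B)$ be the semiring homomorphism with $m_\lambda\mapsto 0$ if $\lambda_{x+1}\ge y+1$ and $m_\lambda\mapsto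 1$ otherwise, and let $\infty\in W(\mathbf B)$ be the one with $m_\lambda\mapsto 1$ for all $\lambda$. In $W^{\mathrm{Sch}}(\mathbf B)$ let $\infty$ be the homomorphism with $s_\lambda\mapsto 1$ for all $\lambda$, and for $x\in\mathbf N$ let $x$ also denote the image of $x$ under the unique semiring map $\mathbf N\to W^{\mathrm{Sch}}(\mathbf B)$, which is the homomorphism sending $f$ to the image in $\mathbf B$ of $f(1,\dots,1,0,0,\dots)$ with $x$ ones. Then the elements $(x,y)$ and $\infty$ are pairwise distinct and exhaust $W(\mathbf B)$, that is, they define a bijection $\mathbf N^2\cup\{\infty\}\to W(\mathbf B)$. The natural map $W(\mathbf B)\to W^{\mathrm{Sch}}(\mathbf B)$ sends $(x,0)$ to $x$ for every $x\in\mathbf N$, and it sends every other element, namely every $(x,y)$ with $y\ge 1$ and $\infty$, to $\infty$. Moreover $x\in W^{\mathrm{Sch}}(\mathbf B)$ is the element with $s_\lambda\mapsto 0$ if $\lambda_{x+1}\ge 1$ and $s_\lambda\mapsto 1$ otherwise. -/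

import Mathlib

namespace BoolWitt

/-- The Boolean semiring `{0, 1}` with `1 + 1 = 1`. -/
inductive BB : Type
  | zero : BB
  | one : BB

namespace BB

/-- Addition: the maximum. -/
def add : BB → BB → BB
  | zero, b => b
  | one, _ => one

/-- Multiplication: the minimum. -/
def mul : BB → BB → BB
  | zero, _ => zero
  | one, b => b

instance : Zero BB := ⟨zero⟩
instance : One BB := ⟨one⟩
instance : Add BB := ⟨add⟩
instance : Mul BB := ⟨mul⟩

instance : CommSemiring BB where
  add_assoc a b c := by cases a <;> cases b <;> cases c <;> rfl
  zero_add a := by cases a <;> rfl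
  add_zero a := by cases a <;> rfl
  add_comm a b := by cases a <;> cases b <;> rfl
  left_distrib a b c := by cases a <;> cases b <;> cases c <;> rfl
  right_distrib a b c := by cases a <;> cases b <;> cases c <;> rfl
  zero_mul a := by cases a <;> rfl
  mul_zero a := by cases a <;> rfl
  mul_assoc a b c := by cases a <;> cases b <;> cases c <;> rfl
  one_mul a := by cases a <;> rfl
  mul_one a := by cases a <;> rfl
  mul_comm a b := by cases a <;> cases b <;> rfl
  nsmul := nsmulRec

theorem one_add_one : (1 : BB) + 1 = 1 := rfl

theorem zero_ne_one : (0 : BB) ≠ 1 := fun h => BB.noConfusion h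

theorem one_add (a : BB) : 1 + a = 1 := rfl

theorem add_one (a : BB) : a + 1 = 1 := by cases a <;> rfl

end BB

noncomputable section

/-- `Λ_ℕ`: the semiring of symmetric functions in `x₀, x₁, …` with coefficients in `ℕ`, that is,
the power series of bounded degree that are invariant under permutations of the variables.
By `mem_LambdaN_iff` it is the `ℕ`-span of the monomial symmetric functions. -/
def LambdaN : Subsemiring (MvPowerSeries ℕ ℕ) where
  carrier := {f | (∀ (σ : Equiv.Perm ℕ) (d : ℕ →₀ ℕ),
      MvPowerSeries.coeff (Finsupp.equivMapDomain σ d) f = MvPowerSeries.coeff d f) ∧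
    ∃ N : ℕ, ∀ d : ℕ →₀ ℕ, MvPowerSeries.coeff d f ≠ 0 → d.degree ≤ N}
  zero_mem' := ⟨fun _ _ => by simp, 0, fun d h => by simp at h⟩
  one_mem' := by
    classical
    refine ⟨fun σ d => ?_, 0, fun d h => ?_⟩
    · have : Finsupp.equivMapDomain σ d = 0 ↔ d = 0 := by
        constructor
        · intro h
          ext i
          have := DFunLike.congr_fun h (σ i)
          simpa using this
        · rintro rfl
          simp
      simp only [MvPowerSeries.coeff_one, this]
    · rw [MvPowerSeries.coeff_one] at h
      have : d = 0 := by
        by_contra h'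
        simp [h'] at h
      simp [this]
  add_mem' := by
    rintro f g ⟨hf, N, hN⟩ ⟨hg, M, hM⟩
    refine ⟨fun σ d => by simp [hf, hg], max N M, fun d h => ?_⟩
    rw [map_add] at h
    by_cases h1 : MvPowerSeries.coeff d f = 0
    · exact le_max_of_le_right (hM d (by simpa [h1] using h))
    · exact le_max_of_le_left (hN d h1)
  mul_mem' := by
    classical
    rintro f g ⟨hf, N, hN⟩ ⟨hg, M, hM⟩
    refine ⟨fun σ d => ?_, N + M, fun d h => ?_⟩
    · rw [MvPowerSeries.coeff_mul, MvPowerSeries.coeff_mul]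
      symm
      refine Finset.sum_equiv
        ((Finsupp.equivCongrLeft σ).prodCongr (Finsupp.equivCongrLeft σ)) ?_ ?_
      · rintro ⟨a, b⟩
        simp only [Finset.HasAntidiagonal.mem_antidiagonal, Equiv.prodCongr_apply, Prod.map_apply,
          Finsupp.equivCongrLeft_apply]
        constructor
        · rintro rfl
          ext i
          simp
        · intro h
          ext i
          have := DFunLike.congr_fun h (σ i)
          simpa using this
      · rintro ⟨a, b⟩ _
        simp [hf, hg]
    · rw [MvPowerSeries.coeff_mul] at h
      obtain ⟨⟨a, b⟩, hab, hne⟩ := Finset.exists_ne_zero_of_sum_ne_zero h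
      rw [Finset.HasAntidiagonal.mem_antidiagonal] at hab
      rw [← hab, map_add]
      exact add_le_add (hN a (left_ne_zero_of_mul hne)) (hM b (right_ne_zero_of_mul hne))

theorem coeff_perm {f : MvPowerSeries ℕ ℕ} (hf : f ∈ LambdaN) (σ : Equiv.Perm ℕ) {d e : ℕ →₀ ℕ}
    (h : ∀ i, e (σ i) = d i) : MvPowerSeries.coeff e f = MvPowerSeries.coeff d f := by
  rw [← hf.1 σ d]
  suffices he : e = Finsupp.equivMapDomain σ d by rw [he]
  ext i
  rw [Finsupp.equivMapDomain_apply, ← h, Equiv.apply_symm_apply]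

open Classical in
/-- The monomial symmetric function `m_μ`: the sum of all distinct monomials obtained from
`x₀^{μ₁} x₁^{μ₂} ⋯` by permuting the variables. Partitions are represented by their Young diagrams;
`μ.rowLen i` is the part `μ_{i+1}`. -/
def mSym (μ : YoungDiagram) : MvPowerSeries ℕ ℕ :=
  fun d => if ∃ σ : Equiv.Perm ℕ, ∀ i, d (σ i) = μ.rowLen i then 1 else 0

/-- The number of entries of a tableau that are equal to `k`. -/
def content {μ : YoungDiagram} (T : SemistandardYoungTableau μ) (k : ℕ) : ℕ :=
  (μ.cells.filter fun c => T c.1 c.2 = k).card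

/-- The Schur function `s_μ = ∑_T x^T`, the sum over the semistandard Young tableaux of shape `μ`:
the coefficient of `x^d` is the number of tableaux with `d k` entries equal to `k` for all `k`. -/
def schur (μ : YoungDiagram) : MvPowerSeries ℕ ℕ :=
  fun d => Nat.card {T : SemistandardYoungTableau μ // ∀ k, content T k = d k}


theorem perm_extend (P : Equiv.Perm ℕ → Prop) (h1 : P 1)
    (hs : ∀ a b τ, P τ → P (Equiv.swap a b * τ)) (S : Finset ℕ) (f : ℕ → ℕ)
    (hf : Set.InjOn f S) : ∃ τ, P τ ∧ ∀ i ∈ S, τ i = f i := by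
  induction S using Finset.induction_on with
  | empty => exact ⟨1, h1, by simp⟩
  | insert a S ha ih =>
    obtain ⟨τ, hP, hτ⟩ := ih (hf.mono (by simp))
    refine ⟨Equiv.swap (τ a) (f a) * τ, hs _ _ _ hP, fun i hi => ?_⟩
    rw [Finset.mem_insert] at hi
    rcases hi with rfl | hi
    · simp
    · have hne : i ≠ a := fun h => ha (h ▸ hi)
      rw [Equiv.Perm.mul_apply, Equiv.swap_apply_of_ne_of_ne, hτ i hi]
      · exact fun h => hne (τ.injective h)
      · rw [hτ i hi]
        exact fun h => hne (hf (by simp [hi]) (by simp) h)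

/-- The number of entries in row `i` that are less than `k`. -/
def cnt {μ : YoungDiagram} (T : SemistandardYoungTableau μ) (k i : ℕ) : ℕ :=
  ((Finset.range (μ.rowLen i)).filter fun j => T i j < k).card

theorem lt_cnt_iff {μ : YoungDiagram} (T : SemistandardYoungTableau μ) (k i j : ℕ) :
    j < cnt T k i ↔ j < μ.rowLen i ∧ T i j < k := by
  have key : ∀ m ≤ μ.rowLen i, ((Finset.range m).filter fun j => T i j < k) =
      Finset.range ((Finset.range m).filter fun j => T i j < k).card := by
    intro m
    induction m with
    | zero => simp
    | succ m ih =>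
      intro hm
      have ih := ih (by omega)
      rw [Finset.range_add_one, Finset.filter_insert]
      split_ifs with h
      · have hall : ((Finset.range m).filter fun j => T i j < k) = Finset.range m := by
          refine Finset.filter_true_of_mem fun j hj => lt_of_le_of_lt ?_ h
          exact T.row_weak (Finset.mem_range.1 hj) (YoungDiagram.mem_iff_lt_rowLen.2 (by omega))
        rw [hall, Finset.card_insert_of_notMem (by simp), Finset.card_range, Finset.range_add_one]
      · exact ih
  have := key _ le_rfl
  have h2 : j ∈ ((Finset.range (μ.rowLen i)).filter fun j => T i j < k) ↔ j < cnt T k i := by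
    rw [this, Finset.mem_range]
    rfl
  rw [← h2]
  simp

theorem cnt_mono {μ : YoungDiagram} (T : SemistandardYoungTableau μ) {k l : ℕ} (h : k ≤ l)
    (i : ℕ) : cnt T k i ≤ cnt T l i := by
  by_contra! hc
  have := (lt_cnt_iff T k i (cnt T l i)).1 hc
  have h2 := (lt_cnt_iff T l i (cnt T l i)).2 ⟨this.1, by omega⟩
  omega

theorem cnt_interlace {μ : YoungDiagram} (T : SemistandardYoungTableau μ) (k : ℕ) {i₁ i₂ : ℕ}
    (h : i₁ < i₂) : cnt T (k + 1) i₂ ≤ cnt T k i₁ := by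
  by_contra! hc
  have h1 := (lt_cnt_iff T (k + 1) i₂ (cnt T k i₁)).1 hc
  have hmem := YoungDiagram.mem_iff_lt_rowLen.2 h1.1
  have hs := T.col_strict h hmem
  have hr := μ.rowLen_anti i₁ i₂ h.le
  have h2 := (lt_cnt_iff T k i₁ (cnt T k i₁)).2 ⟨by omega, by omega⟩
  omega

theorem content_eq_sum {μ : YoungDiagram} (T : SemistandardYoungTableau μ) (k : ℕ) :
    content T k + ∑ i ∈ Finset.range (μ.colLen 0), cnt T k i =
      ∑ i ∈ Finset.range (μ.colLen 0), cnt T (k + 1) i := by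
  have h1 : content T k = ∑ i ∈ Finset.range (μ.colLen 0),
      ((Finset.range (μ.rowLen i)).filter fun j => T i j = k).card := by
    rw [content, ← Finset.card_sigma]
    refine Finset.card_bij' (fun c _ => ⟨c.1, c.2⟩) (fun c _ => (c.1, c.2)) ?_ ?_ ?_ ?_
    · rintro ⟨i, j⟩ h
      simp only [Finset.mem_filter, YoungDiagram.mem_cells] at h
      simp only [Finset.mem_sigma, Finset.mem_range, Finset.mem_filter]
      refine ⟨?_, YoungDiagram.mem_iff_lt_rowLen.1 h.1, h.2⟩
      exact YoungDiagram.mem_iff_lt_colLen.1 (μ.up_left_mem le_rfl (Nat.zero_le _) h.1)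
    · rintro ⟨i, j⟩ h
      simp only [Finset.mem_sigma, Finset.mem_range, Finset.mem_filter] at h
      simp only [Finset.mem_filter, YoungDiagram.mem_cells]
      exact ⟨YoungDiagram.mem_iff_lt_rowLen.2 h.2.1, h.2.2⟩
    · rintro ⟨i, j⟩ _
      rfl
    · rintro ⟨i, j⟩ _
      rfl
  rw [h1, ← Finset.sum_add_distrib]
  refine Finset.sum_congr rfl fun i _ => ?_
  rw [cnt, cnt, ← Finset.card_union_of_disjoint]
  · congr 1
    ext j
    simp only [Finset.mem_union, Finset.mem_filter, Finset.mem_range]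
    constructor
    · rintro (h | h)
      · exact ⟨h.1, by omega⟩
      · exact ⟨h.1, by omega⟩
    · rintro ⟨h, h'⟩
      rcases Nat.lt_succ_iff_lt_or_eq.1 h' with h' | h'
      · exact Or.inr ⟨h, h'⟩
      · exact Or.inl ⟨h, h'⟩
  · rw [Finset.disjoint_filter]
    intro j _ h
    omega

/-- Lower end of the range of `cnt T (k + 1) i` when the other entries are fixed. -/
def lo {μ : YoungDiagram} (T : SemistandardYoungTableau μ) (k i : ℕ) : ℕ :=
  max (cnt T k i) (cnt T (k + 2) (i + 1))

/-- Upper end of the range of `cnt T (k + 1) i` when the other entries are fixed. -/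
def hi {μ : YoungDiagram} (T : SemistandardYoungTableau μ) (k : ℕ) : ℕ → ℕ
  | 0 => cnt T (k + 2) 0
  | i + 1 => min (cnt T (k + 2) (i + 1)) (cnt T k i)

theorem lo_le {μ : YoungDiagram} (T : SemistandardYoungTableau μ) (k i : ℕ) :
    lo T k i ≤ cnt T (k + 1) i :=
  max_le (cnt_mono T (by omega) i) (cnt_interlace T (k + 1) (by omega))

theorem le_hi {μ : YoungDiagram} (T : SemistandardYoungTableau μ) (k i : ℕ) :
    cnt T (k + 1) i ≤ hi T k i := by
  cases i with
  | zero => exact cnt_mono T (by omega) 0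
  | succ i => exact le_min (cnt_mono T (by omega) _) (cnt_interlace T k (by omega))

/-- The reflected value of `cnt T (k + 1) i`. -/
def mid {μ : YoungDiagram} (T : SemistandardYoungTableau μ) (k i : ℕ) : ℕ :=
  lo T k i + hi T k i - cnt T (k + 1) i

theorem cnt_le_mid {μ : YoungDiagram} (T : SemistandardYoungTableau μ) (k i : ℕ) :
    cnt T k i ≤ mid T k i := by
  have h1 := lo_le T k i
  have h2 := le_hi T k i
  have h3 : cnt T k i ≤ lo T k i := le_max_left _ _
  unfold mid
  omega

theorem mid_le_cnt {μ : YoungDiagram} (T : SemistandardYoungTableau μ) (k i : ℕ) :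
    mid T k i ≤ cnt T (k + 2) i := by
  have h1 := lo_le T k i
  have h2 := le_hi T k i
  have h3 : hi T k i ≤ cnt T (k + 2) i := by
    cases i with
    | zero => exact le_rfl
    | succ i => exact min_le_left _ _
  unfold mid
  omega

theorem mid_le_cnt_of_lt {μ : YoungDiagram} (T : SemistandardYoungTableau μ) (k : ℕ) {i₁ i₂ : ℕ}
    (h : i₁ < i₂) : mid T k i₂ ≤ cnt T k i₁ := by
  obtain ⟨i, rfl⟩ : ∃ i, i₂ = i + 1 := ⟨i₂ - 1, by omega⟩
  have h1 := lo_le T k (i + 1)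
  have h2 := le_hi T k (i + 1)
  have h3 : hi T k (i + 1) ≤ cnt T k i := min_le_right _ _
  have h4 : cnt T k i ≤ cnt T k i₁ := by
    rcases eq_or_lt_of_le (Nat.lt_succ_iff.1 h) with rfl | h'
    · exact le_rfl
    · exact (cnt_mono T (by omega) i).trans (cnt_interlace T k h')
  unfold mid
  omega

theorem cnt_le_mid_of_lt {μ : YoungDiagram} (T : SemistandardYoungTableau μ) (k : ℕ) {i₁ i₂ : ℕ}
    (h : i₁ < i₂) : cnt T (k + 2) i₂ ≤ mid T k i₁ := by
  have h1 := lo_le T k i₁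
  have h2 := le_hi T k i₁
  have h3 : cnt T (k + 2) (i₁ + 1) ≤ lo T k i₁ := le_max_right _ _
  have h4 : cnt T (k + 2) i₂ ≤ cnt T (k + 2) (i₁ + 1) := by
    rcases eq_or_lt_of_le (Nat.succ_le_of_lt h) with h' | h'
    · rw [← h']
    · exact (cnt_mono T (by omega) i₂).trans (cnt_interlace T (k + 2) h')
  unfold mid
  omega

/-- The involution of Bender and Knuth, exchanging the multiplicities of `k` and `k + 1`. -/
def bk {μ : YoungDiagram} (k : ℕ) (T : SemistandardYoungTableau μ) :
    SemistandardYoungTableau μ where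
  entry i j := if cnt T k i ≤ j ∧ j < cnt T (k + 2) i then (if j < mid T k i then k else k + 1)
    else T i j
  row_weak' := by
    intro i j₁ j₂ hj hmem
    have hw := T.row_weak hj hmem
    have hl := YoungDiagram.mem_iff_lt_rowLen.1 hmem
    have a1 := lt_cnt_iff T k i j₁
    have a2 := lt_cnt_iff T k i j₂
    have b1 := lt_cnt_iff T (k + 2) i j₁
    have b2 := lt_cnt_iff T (k + 2) i j₂
    split_ifs <;> omega
  col_strict' := by
    intro i₁ i₂ j hi hmem
    have hw := T.col_strict hi hmem
    have hl := YoungDiagram.mem_iff_lt_rowLen.1 hmem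
    have hr := μ.rowLen_anti i₁ i₂ hi.le
    have a1 := lt_cnt_iff T k i₁ j
    have a2 := lt_cnt_iff T k i₂ j
    have b1 := lt_cnt_iff T (k + 2) i₁ j
    have b2 := lt_cnt_iff T (k + 2) i₂ j
    have c1 := mid_le_cnt_of_lt T k hi
    have c2 := cnt_le_mid_of_lt T k hi
    split_ifs <;> omega
  zeros' := by
    intro i j hmem
    have hl := mt YoungDiagram.mem_iff_lt_rowLen.2 hmem
    have b1 := lt_cnt_iff T (k + 2) i j
    rw [if_neg (by omega)]
    exact T.zeros hmem

theorem bk_apply {μ : YoungDiagram} (k : ℕ) (T : SemistandardYoungTableau μ) (i j : ℕ) :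
    bk k T i j = if cnt T k i ≤ j ∧ j < cnt T (k + 2) i then (if j < mid T k i then k else k + 1)
      else T i j := rfl

theorem cnt_ext {a b : ℕ} (h : ∀ j, j < a ↔ j < b) : a = b := by
  have h1 := h a
  have h2 := h b
  omega

theorem cnt_bk_mid {μ : YoungDiagram} (k : ℕ) (T : SemistandardYoungTableau μ) (i : ℕ) :
    cnt (bk k T) (k + 1) i = mid T k i := by
  refine cnt_ext fun j => ?_
  rw [lt_cnt_iff, bk_apply]
  have a1 := lt_cnt_iff T k i j
  have b1 := lt_cnt_iff T (k + 2) i j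
  have c1 := cnt_le_mid T k i
  have c2 := mid_le_cnt T k i
  split_ifs <;> omega

theorem cnt_bk {μ : YoungDiagram} (k : ℕ) (T : SemistandardYoungTableau μ) (l i : ℕ)
    (hl : l ≠ k + 1) : cnt (bk k T) l i = cnt T l i := by
  refine cnt_ext fun j => ?_
  rw [lt_cnt_iff, lt_cnt_iff, bk_apply]
  have a1 := lt_cnt_iff T k i j
  have b1 := lt_cnt_iff T (k + 2) i j
  split_ifs <;> omega

theorem bk_bk {μ : YoungDiagram} (k : ℕ) (T : SemistandardYoungTableau μ) :
    bk k (bk k T) = T := by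
  have e1 : ∀ i, cnt (bk k T) k i = cnt T k i := fun i => cnt_bk k T k i (by omega)
  have e2 : ∀ i, cnt (bk k T) (k + 2) i = cnt T (k + 2) i := fun i => cnt_bk k T _ i (by omega)
  have e3 : ∀ i, mid (bk k T) k i = cnt T (k + 1) i := by
    intro i
    have h1 : lo (bk k T) k i = lo T k i := by simp only [lo, e1, e2]
    have h2 : hi (bk k T) k i = hi T k i := by
      cases i <;> simp only [hi, e1, e2]
    have h3 := lo_le T k i
    have h4 := le_hi T k i
    have h5 : mid T k i = lo T k i + hi T k i - cnt T (k + 1) i := rfl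
    rw [mid, h1, h2, cnt_bk_mid]
    omega
  ext i j
  rw [bk_apply, e1, e2, e3, bk_apply]
  have a1 := lt_cnt_iff T k i j
  have b1 := lt_cnt_iff T (k + 1) i j
  have c1 := lt_cnt_iff T (k + 2) i j
  split_ifs <;> omega

theorem sum_mid {μ : YoungDiagram} (k : ℕ) (T : SemistandardYoungTableau μ) :
    ∑ i ∈ Finset.range (μ.colLen 0), mid T k i +
        ∑ i ∈ Finset.range (μ.colLen 0), cnt T (k + 1) i =
      ∑ i ∈ Finset.range (μ.colLen 0), cnt T k i +
        ∑ i ∈ Finset.range (μ.colLen 0), cnt T (k + 2) i := by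
  have h1 : ∀ i, mid T k i + cnt T (k + 1) i = lo T k i + hi T k i := by
    intro i
    have h3 := lo_le T k i
    have h4 := le_hi T k i
    unfold mid
    omega
  have key : ∀ n, ∑ i ∈ Finset.range n, (lo T k i + hi T k i) + hi T k n =
      ∑ i ∈ Finset.range n, (cnt T k i + cnt T (k + 2) i) + cnt T (k + 2) n := by
    intro n
    induction n with
    | zero => simp [hi]
    | succ n ih =>
      rw [Finset.sum_range_succ, Finset.sum_range_succ]
      have : lo T k n + hi T k (n + 1) = cnt T k n + cnt T (k + 2) (n + 1) := by
        simp only [lo, hi]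
        omega
      omega
  have h0 : cnt T (k + 2) (μ.colLen 0) = 0 := by
    by_contra h
    have := ((lt_cnt_iff T (k + 2) (μ.colLen 0) 0).1 (by omega)).1
    have := YoungDiagram.mem_iff_lt_colLen.1 (YoungDiagram.mem_iff_lt_rowLen.2 this)
    omega
  have h00 : hi T k (μ.colLen 0) = 0 := by
    cases h : μ.colLen 0 with
    | zero => rw [h] at h0; exact h0
    | succ n => rw [h] at h0; simp [hi, h0]
  have := key (μ.colLen 0)
  rw [h0, h00] at this
  rw [← Finset.sum_add_distrib, ← Finset.sum_add_distrib, Finset.sum_congr rfl fun i _ => h1 i]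
  exact this

theorem content_bk {μ : YoungDiagram} (k : ℕ) (T : SemistandardYoungTableau μ) (l : ℕ) :
    content (bk k T) l = content T (Equiv.swap k (k + 1) l) := by
  have s0 := sum_mid k T
  have s1 : ∑ i ∈ Finset.range (μ.colLen 0), cnt (bk k T) (k + 1) i =
      ∑ i ∈ Finset.range (μ.colLen 0), mid T k i :=
    Finset.sum_congr rfl fun i _ => cnt_bk_mid k T i
  have s2 : ∀ l, l ≠ k + 1 → ∑ i ∈ Finset.range (μ.colLen 0), cnt (bk k T) l i =
      ∑ i ∈ Finset.range (μ.colLen 0), cnt T l i :=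
    fun l hl => Finset.sum_congr rfl fun i _ => cnt_bk k T l i hl
  have t1 := content_eq_sum (bk k T)
  have t2 := content_eq_sum T
  by_cases h1 : l = k
  · subst h1
    rw [Equiv.swap_apply_left]
    have u1 := t1 l
    have u2 := t2 (l + 1)
    have u3 := s2 l (by omega)
    rw [show l + 1 + 1 = l + 2 from rfl] at u2
    omega
  · by_cases h2 : l = k + 1
    · subst h2
      rw [Equiv.swap_apply_right]
      have u1 := t1 (k + 1)
      have u2 := t2 k
      have u3 := s2 (k + 2) (by omega)
      rw [show k + 1 + 1 = k + 2 from rfl] at u1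
      omega
    · rw [Equiv.swap_apply_of_ne_of_ne h1 h2]
      have := t1 l
      have := t2 l
      have := s2 l (by omega)
      have := s2 (l + 1) (by omega)
      omega

theorem coeff_schur (μ : YoungDiagram) (d : ℕ →₀ ℕ) : MvPowerSeries.coeff d (schur μ) =
    Nat.card {T : SemistandardYoungTableau μ // ∀ k, content T k = d k} := rfl

theorem schur_swap_succ (μ : YoungDiagram) (k : ℕ) (d : ℕ →₀ ℕ) :
    MvPowerSeries.coeff (Finsupp.equivMapDomain (Equiv.swap k (k + 1)) d) (schur μ) =
      MvPowerSeries.coeff d (schur μ) := by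
  rw [coeff_schur, coeff_schur]
  refine Nat.card_congr ⟨fun T => ⟨bk k T.1, fun l => ?_⟩, fun T => ⟨bk k T.1, fun l => ?_⟩,
    fun T => Subtype.ext (bk_bk k T.1), fun T => Subtype.ext (bk_bk k T.1)⟩
  · rw [content_bk, T.2, Finsupp.equivMapDomain_apply, Equiv.symm_swap, Equiv.swap_apply_self]
  · rw [content_bk, T.2, Finsupp.equivMapDomain_apply, Equiv.symm_swap]

theorem schur_perm (μ : YoungDiagram) (σ : Equiv.Perm ℕ) (d : ℕ →₀ ℕ) :
    MvPowerSeries.coeff (Finsupp.equivMapDomain σ d) (schur μ) =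
      MvPowerSeries.coeff d (schur μ) := by
  let P : Equiv.Perm ℕ → Prop := fun τ => ∀ d : ℕ →₀ ℕ,
    MvPowerSeries.coeff (Finsupp.equivMapDomain τ d) (schur μ) = MvPowerSeries.coeff d (schur μ)
  have hP1 : P 1 := fun d => by
    rw [show Finsupp.equivMapDomain (1 : Equiv.Perm ℕ) d = d from Finsupp.equivMapDomain_refl d]
  have hmul : ∀ σ τ, P σ → P τ → P (σ * τ) := fun σ τ hσ hτ d => by
    rw [show Finsupp.equivMapDomain (σ * τ) d =
      Finsupp.equivMapDomain σ (Finsupp.equivMapDomain τ d) from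
      Finsupp.equivMapDomain_trans τ σ d, hσ, hτ]
  have hadd : ∀ a n, P (Equiv.swap a (a + n)) := by
    intro a n
    induction n with
    | zero =>
      rw [add_zero, Equiv.swap_self]
      exact hP1
    | succ n ih =>
      rcases Nat.eq_zero_or_pos n with rfl | hn
      · exact schur_swap_succ μ a
      · have : Equiv.swap a (a + (n + 1)) = Equiv.swap (a + n) (a + n + 1) * Equiv.swap a (a + n) *
            Equiv.swap (a + n) (a + n + 1) := by
          rw [← add_assoc, Equiv.swap_mul_swap_mul_swap (by omega) (by omega), Equiv.swap_comm]
        rw [this]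
        exact hmul _ _ (hmul _ _ (schur_swap_succ μ _) ih) (schur_swap_succ μ _)
  have hswap : ∀ a b, P (Equiv.swap a b) := by
    intro a b
    rcases le_total a b with h | h
    · obtain ⟨n, rfl⟩ := Nat.exists_eq_add_of_le h
      exact hadd a n
    · obtain ⟨n, rfl⟩ := Nat.exists_eq_add_of_le h
      rw [Equiv.swap_comm]
      exact hadd b n
  obtain ⟨τ, hτ, h⟩ := perm_extend P hP1 (fun a b τ hτ => hmul _ _ (hswap a b) hτ)
    d.support σ σ.injective.injOn
  have : Finsupp.equivMapDomain σ d = Finsupp.equivMapDomain τ d := by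
    ext i
    rw [Finsupp.equivMapDomain_apply, Finsupp.equivMapDomain_apply]
    by_cases h1 : d (σ.symm i) = 0
    · by_cases h2 : d (τ.symm i) = 0
      · rw [h1, h2]
      · have := h (τ.symm i) (by simp [h2])
        rw [Equiv.apply_symm_apply] at this
        exact absurd (by rw [this, Equiv.symm_apply_apply] at h1; exact h1) h2
    · have := h (σ.symm i) (by simp [h1])
      rw [Equiv.apply_symm_apply] at this
      rw [← this, Equiv.symm_apply_apply, this]
  rw [this]
  exact hτ d

theorem schur_mem_LambdaN (μ : YoungDiagram) : schur μ ∈ LambdaN := by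
  refine ⟨schur_perm μ, μ.card, fun d h => ?_⟩
  rw [coeff_schur] at h
  obtain ⟨⟨T, hT⟩⟩ := (Nat.card_ne_zero.1 h).1
  rw [Finsupp.degree_apply, ← Finset.sum_congr rfl fun k _ => hT k]
  unfold content
  rw [← Finset.card_eq_sum_card_fiberwise (f := fun c : ℕ × ℕ => T c.1 c.2)]
  intro c hc
  simp only [Finset.mem_coe, Finsupp.mem_support_iff, ← hT]
  have hmem : c ∈ μ.cells.filter fun c' => T c'.1 c'.2 = T c.1 c.2 := Finset.mem_filter.2 ⟨hc, rfl⟩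
  exact (Finset.card_pos.2 ⟨c, hmem⟩).ne'

/-- `Λ^Sch`: the subsemiring of symmetric functions generated by the Schur functions. By the
Littlewood-Richardson rule this is the `ℕ`-span of the Schur functions. -/
def LambdaSch : Subsemiring (MvPowerSeries ℕ ℕ) := Subsemiring.closure (Set.range schur)

theorem schur_mem_LambdaSch (μ : YoungDiagram) : schur μ ∈ LambdaSch :=
  Subsemiring.subset_closure ⟨μ, rfl⟩

theorem LambdaSch_le : LambdaSch ≤ LambdaN :=
  Subsemiring.closure_le.2 (by rintro _ ⟨μ, rfl⟩; exact schur_mem_LambdaN μ)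

/-- The big Witt vectors with entries in `A`. -/
abbrev Witt (A : Type*) [CommSemiring A] := LambdaN →+* A

/-- The Schur Witt vectors with entries in `A`. -/
abbrev WittSch (A : Type*) [CommSemiring A] := LambdaSch →+* A

/-- The natural map `W(A) → W^Sch(A)`: restriction along the inclusion `Λ^Sch ⊆ Λ_ℕ`. -/
def toSch {A : Type*} [CommSemiring A] (w : Witt A) : WittSch A :=
  w.comp (Subsemiring.inclusion LambdaSch_le)

/-! ### The image of a natural number -/

theorem finite_restrict (n : ℕ) (f : LambdaN) : {d : ℕ →₀ ℕ | d.support ⊆ Finset.range n ∧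
    MvPowerSeries.coeff d (f : MvPowerSeries ℕ ℕ) ≠ 0}.Finite := by
  obtain ⟨_, N, hN⟩ := f.2
  refine (Set.finite_Iic (Finsupp.indicator (Finset.range n) fun _ _ => N)).subset ?_
  rintro d ⟨h1, h2⟩ i
  by_cases hi : i ∈ Finset.range n
  · rw [Finsupp.indicator_of_mem hi]
    exact (Finsupp.le_degree i d).trans (hN d h2)
  · have : d i = 0 := by
      by_contra h
      exact hi (h1 (by simpa using h))
    rw [this]
    exact Nat.zero_le _

/-- The polynomial `f(x₀, …, x_{n-1}, 0, 0, …)`. -/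
def restrictFun (n : ℕ) (f : LambdaN) : MvPolynomial ℕ ℕ :=
  ∑ d ∈ (finite_restrict n f).toFinset,
    MvPolynomial.monomial d (MvPowerSeries.coeff d (f : MvPowerSeries ℕ ℕ))

theorem coeff_restrictFun (n : ℕ) (f : LambdaN) (d : ℕ →₀ ℕ) :
    MvPolynomial.coeff d (restrictFun n f) = if d.support ⊆ Finset.range n then
      MvPowerSeries.coeff d (f : MvPowerSeries ℕ ℕ) else 0 := by
  classical
  rw [restrictFun, MvPolynomial.coeff_sum]
  simp only [MvPolynomial.coeff_monomial]
  rw [Finset.sum_ite_eq']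
  simp only [Set.Finite.mem_toFinset, Set.mem_ofPred_eq]
  by_cases h1 : d.support ⊆ Finset.range n
  · by_cases h2 : MvPowerSeries.coeff d (f : MvPowerSeries ℕ ℕ) = 0
    · simp [h2]
    · simp [h1, h2]
  · simp [h1]

/-- The semiring homomorphism `f ↦ f(x₀, …, x_{n-1}, 0, 0, …)`. -/
def restrict (n : ℕ) : LambdaN →+* MvPolynomial ℕ ℕ where
  toFun := restrictFun n
  map_zero' := by
    ext d
    rw [coeff_restrictFun]
    simp
  map_one' := by
    classical
    ext d
    rw [coeff_restrictFun, MvPolynomial.coeff_one]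
    by_cases h : d = 0
    · subst h
      simp
    · have h' : 0 ≠ d := fun h' => h h'.symm
      simp [MvPowerSeries.coeff_one, h, h']
  map_add' f g := by
    ext d
    rw [MvPolynomial.coeff_add, coeff_restrictFun, coeff_restrictFun, coeff_restrictFun]
    split_ifs <;> simp
  map_mul' f g := by
    classical
    ext d
    rw [MvPolynomial.coeff_mul, coeff_restrictFun, Subsemiring.coe_mul, MvPowerSeries.coeff_mul]
    split_ifs with h
    · refine Finset.sum_congr rfl fun p hp => ?_
      rw [Finset.HasAntidiagonal.mem_antidiagonal] at hp
      have h1 : p.1.support ⊆ d.support := Finsupp.support_mono (by rw [← hp]; simp)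
      have h2 : p.2.support ⊆ d.support := Finsupp.support_mono (by rw [← hp]; simp)
      rw [coeff_restrictFun, coeff_restrictFun, if_pos (h1.trans h), if_pos (h2.trans h)]
    · symm
      refine Finset.sum_eq_zero fun p hp => ?_
      rw [Finset.HasAntidiagonal.mem_antidiagonal] at hp
      rw [coeff_restrictFun, coeff_restrictFun]
      split_ifs with h1 h2
      · exact absurd (hp ▸ Finsupp.support_add.trans (Finset.union_subset h1 h2)) h
      all_goals simp

/-- The semiring homomorphism `f ↦ f(1, …, 1, 0, 0, …)` with `n` ones. -/
def evalOnes (n : ℕ) : LambdaN →+* ℕ := (MvPolynomial.eval fun _ => 1).comp (restrict n)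

/-- The image of `n` under the unique semiring map `ℕ → W^Sch(A)`. The unit of `W^Sch(A)` is induced
by the co-unit `f ↦ f(1, 0, 0, …)`, and sums of Witt vectors are induced by the co-addition that
substitutes a disjoint union of two sets of variables into `f`; so the sum of `n` copies of the unit
is `f ↦ f(1, …, 1, 0, 0, …)` with `n` ones. -/
def natSch (A : Type*) [CommSemiring A] (n : ℕ) : WittSch A :=
  (Nat.castRingHom A).comp ((evalOnes n).comp (Subsemiring.inclusion LambdaSch_le))

/-! ### The elements `∞` and `(x, y)` -/

open Classical in
/-- The homomorphism sending every nonzero element to `1`. -/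
def nonzeroHom (S : Subsemiring (MvPowerSeries ℕ ℕ)) : S →+* BB where
  toFun f := if f = 0 then 0 else 1
  map_zero' := if_pos rfl
  map_one' := if_neg one_ne_zero
  map_add' f g := by
    by_cases hf : f = 0
    · simp [hf]
    · have : f + g ≠ 0 := by
        intro h
        apply hf
        ext d
        have := congrArg (fun f : S => MvPowerSeries.coeff d (f : MvPowerSeries ℕ ℕ)) h
        simp only [Subsemiring.coe_add, map_add, Subsemiring.coe_zero, map_zero] at this
        simp only [Subsemiring.coe_zero, map_zero]
        omega
      rw [if_neg this, if_neg hf, BB.one_add]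
  map_mul' f g := by
    have : f * g = 0 ↔ f = 0 ∨ g = 0 := by
      simp only [Subtype.ext_iff, Subsemiring.coe_zero, mul_eq_zero]
    by_cases hf : f = 0 <;> by_cases hg : g = 0 <;> simp [this, hf, hg]

/-- The number of exponents of the monomial `x^d` that are greater than `y`. -/
def bigRows (y : ℕ) (d : ℕ →₀ ℕ) : Finset ℕ := d.support.filter fun i => y < d i

theorem mem_bigRows {y i : ℕ} {d : ℕ →₀ ℕ} : i ∈ bigRows y d ↔ y < d i := by
  simp only [bigRows, Finset.mem_filter, Finsupp.mem_support_iff]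
  omega

theorem exists_aligned {a b : ℕ →₀ ℕ} (y : ℕ)
    (h : (bigRows y b).card ≤ (bigRows y a).card) :
    ∃ σ : Equiv.Perm ℕ, bigRows y (a + Finsupp.equivMapDomain σ b) ⊆ bigRows y a := by
  classical
  obtain ⟨g, hg⟩ : ∃ g : ℕ → ℕ, Set.InjOn g (bigRows y b) ∧
      ∀ i ∈ bigRows y b, g i ∈ bigRows y a := by
    obtain ⟨e, he⟩ := Finset.exists_subset_card_eq h
    obtain ⟨φ⟩ : Nonempty (bigRows y b ≃ e) :=
      Fintype.card_eq.1 (by simp [he.2])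
    refine ⟨fun i => if hi : i ∈ bigRows y b then φ ⟨i, hi⟩ else 0, ?_, ?_⟩
    · intro i hi j hj hij
      simp only [Finset.mem_coe] at hi hj
      simp only [hi, hj, dif_pos] at hij
      simpa using φ.injective (Subtype.ext hij)
    · intro i hi
      simp only [hi, dif_pos]
      exact he.1 (φ ⟨i, hi⟩).2
  let M := a.support.sup id + 1
  have hM : ∀ i, M ≤ i → a i = 0 := by
    intro i hi
    by_contra h0
    have : id i ≤ a.support.sup id := Finset.le_sup (Finsupp.mem_support_iff.2 h0)
    simp only [id, M] at this hi
    omega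
  have hlt : ∀ i ∈ bigRows y a, i < M := by
    intro i hi
    by_contra! h0
    have := hM i h0
    rw [mem_bigRows] at hi
    omega
  obtain ⟨σ, _, hσ⟩ := perm_extend (fun _ => True) trivial (fun _ _ _ _ => trivial) b.support
    (fun i => if i ∈ bigRows y b then g i else M + i) (by
      intro i _ j _ hij
      by_cases hi : i ∈ bigRows y b <;> by_cases hj : j ∈ bigRows y b <;>
        simp only [hi, hj, if_true, if_false] at hij
      · exact hg.1 hi hj hij
      · have := hlt _ (hg.2 i hi)
        omega
      · have := hlt _ (hg.2 j hj)
        omega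
      · omega)
  refine ⟨σ, fun i hi => ?_⟩
  obtain ⟨j, rfl⟩ := σ.surjective i
  rw [mem_bigRows, Finsupp.add_apply, Finsupp.equivMapDomain_apply, Equiv.symm_apply_apply] at hi
  rw [mem_bigRows]
  by_cases hj : b j = 0
  · omega
  · have hs := hσ j (Finsupp.mem_support_iff.2 hj)
    by_cases hjb : j ∈ bigRows y b
    · rw [if_pos hjb] at hs
      rw [hs, ← mem_bigRows]
      exact hg.2 j hjb
    · rw [if_neg hjb] at hs
      have h0 := hM (σ j) (by omega)
      rw [mem_bigRows] at hjb
      omega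

/-- The predicate that some monomial of `f` has at most `x` exponents greater than `y`. -/
def Survives (x y : ℕ) (f : MvPowerSeries ℕ ℕ) : Prop :=
  ∃ d : ℕ →₀ ℕ, MvPowerSeries.coeff d f ≠ 0 ∧ (bigRows y d).card ≤ x

theorem survives_add (x y : ℕ) (f g : MvPowerSeries ℕ ℕ) :
    Survives x y (f + g) ↔ Survives x y f ∨ Survives x y g := by
  simp only [Survives, ← exists_or]
  refine exists_congr fun d => ?_
  rw [← or_and_right, map_add, ne_eq, Nat.add_eq_zero_iff]
  tauto

theorem coeff_add_mul_ne_zero {f g : MvPowerSeries ℕ ℕ} {a b : ℕ →₀ ℕ}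
    (ha : MvPowerSeries.coeff a f ≠ 0) (hb : MvPowerSeries.coeff b g ≠ 0) :
    MvPowerSeries.coeff (a + b) (f * g) ≠ 0 := by
  classical
  rw [MvPowerSeries.coeff_mul]
  intro h
  have := Finset.sum_eq_zero_iff.1 h (a, b) (by simp)
  exact mul_ne_zero ha hb this

theorem survives_mul_aux (x y : ℕ) {f g : MvPowerSeries ℕ ℕ} (hg : g ∈ LambdaN)
    {a b : ℕ →₀ ℕ} (ha : MvPowerSeries.coeff a f ≠ 0) (hb : MvPowerSeries.coeff b g ≠ 0)
    (hax : (bigRows y a).card ≤ x) (h : (bigRows y b).card ≤ (bigRows y a).card) :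
    Survives x y (f * g) := by
  obtain ⟨σ, hσ⟩ := exists_aligned y h
  refine ⟨_, coeff_add_mul_ne_zero ha (b := Finsupp.equivMapDomain σ b) ?_,
    (Finset.card_le_card hσ).trans hax⟩
  rw [hg.1]
  exact hb

theorem survives_mul (x y : ℕ) {f g : MvPowerSeries ℕ ℕ} (hf : f ∈ LambdaN) (hg : g ∈ LambdaN) :
    Survives x y (f * g) ↔ Survives x y f ∧ Survives x y g := by
  classical
  constructor
  · rintro ⟨d, hd, hx⟩
    rw [MvPowerSeries.coeff_mul] at hd
    obtain ⟨⟨a, b⟩, hab, hne⟩ := Finset.exists_ne_zero_of_sum_ne_zero hd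
    rw [Finset.HasAntidiagonal.mem_antidiagonal] at hab
    refine ⟨⟨a, left_ne_zero_of_mul hne, le_trans (Finset.card_le_card fun i hi => ?_) hx⟩,
      ⟨b, right_ne_zero_of_mul hne, le_trans (Finset.card_le_card fun i hi => ?_) hx⟩⟩
    all_goals
      rw [mem_bigRows] at hi ⊢
      rw [← hab, Finsupp.add_apply]
      dsimp only
      omega
  · rintro ⟨⟨a, ha, hax⟩, ⟨b, hb, hbx⟩⟩
    rcases le_total (bigRows y b).card (bigRows y a).card with h | h
    · exact survives_mul_aux x y hg ha hb hax h
    · rw [mul_comm]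
      exact survives_mul_aux x y hf hb ha hbx h

open Classical in
/-- The element `(x, y)` of `W(𝔹)`. By `pairWitt_mSym` it is the semiring homomorphism that sends
`m_μ` to `0` if `μ_{x+1} ≥ y + 1` and to `1` otherwise. -/
def pairWitt (x y : ℕ) : Witt BB where
  toFun f := if Survives x y f then 1 else 0
  map_zero' := if_neg (by rintro ⟨d, h, _⟩; simp at h)
  map_one' := if_pos ⟨0, by simp, by simp [bigRows]⟩
  map_add' f g := by
    rw [Subsemiring.coe_add]
    by_cases hf : Survives x y f <;> by_cases hg : Survives x y g <;>
      simp [survives_add, hf, hg, BB.one_add_one]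
  map_mul' f g := by
    rw [Subsemiring.coe_mul]
    by_cases hf : Survives x y f <;> by_cases hg : Survives x y g <;>
      simp [survives_mul x y f.2 g.2, hf, hg]


/-! ### Values on the two bases -/

open Classical in
theorem coeff_mSym (μ : YoungDiagram) (d : ℕ →₀ ℕ) : MvPowerSeries.coeff d (mSym μ) =
    if ∃ σ : Equiv.Perm ℕ, ∀ i, d (σ i) = μ.rowLen i then 1 else 0 := rfl

theorem coeff_mSym_ne_zero (μ : YoungDiagram) (d : ℕ →₀ ℕ) : MvPowerSeries.coeff d (mSym μ) ≠ 0 ↔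
    ∃ σ : Equiv.Perm ℕ, ∀ i, d (σ i) = μ.rowLen i := by
  rw [coeff_mSym]
  split_ifs with h <;> simp [h]

/-- The parts of a partition as an exponent vector. -/
def parts (μ : YoungDiagram) : ℕ →₀ ℕ :=
  Finsupp.onFinset (Finset.range (μ.colLen 0)) μ.rowLen fun i hi => by
    rw [Finset.mem_range, ← YoungDiagram.mem_iff_lt_colLen, YoungDiagram.mem_iff_lt_rowLen]
    omega

theorem parts_apply (μ : YoungDiagram) (i : ℕ) : parts μ i = μ.rowLen i := rfl

theorem bigRows_parts (μ : YoungDiagram) (y : ℕ) :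
    bigRows y (parts μ) = Finset.range (μ.colLen y) := by
  ext i
  rw [mem_bigRows, parts_apply, Finset.mem_range, ← YoungDiagram.mem_iff_lt_colLen,
    YoungDiagram.mem_iff_lt_rowLen]

theorem card_bigRows {μ : YoungDiagram} {d : ℕ →₀ ℕ} {σ : Equiv.Perm ℕ}
    (h : ∀ i, d (σ i) = μ.rowLen i) (y : ℕ) : (bigRows y d).card = μ.colLen y := by
  have : bigRows y d = (bigRows y (parts μ)).map σ.toEmbedding := by
    ext i
    rw [Finset.mem_map_equiv, mem_bigRows, mem_bigRows, parts_apply, ← h, Equiv.apply_symm_apply]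
  rw [this, Finset.card_map, bigRows_parts, Finset.card_range]

theorem eq_of_colLen {μ ν : YoungDiagram} (h : ∀ y, μ.colLen y = ν.colLen y) : μ = ν := by
  refine YoungDiagram.ext (Finset.ext ?_)
  rintro ⟨i, j⟩
  rw [YoungDiagram.mem_cells, YoungDiagram.mem_cells, YoungDiagram.mem_iff_lt_colLen,
    YoungDiagram.mem_iff_lt_colLen, h]

theorem coeff_parts_mSym (μ ν : YoungDiagram) [Decidable (μ = ν)] :
    MvPowerSeries.coeff (parts μ) (mSym ν) = if μ = ν then 1 else 0 := by
  split_ifs with h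
  · subst h
    rw [coeff_mSym, if_pos ⟨1, fun i => rfl⟩]
  · by_contra h'
    obtain ⟨σ, hσ⟩ := (coeff_mSym_ne_zero ν _).1 h'
    refine h (eq_of_colLen fun y => ?_)
    rw [← card_bigRows hσ, bigRows_parts, Finset.card_range]

theorem mSym_mem_LambdaN (μ : YoungDiagram) : mSym μ ∈ LambdaN := by
  refine ⟨fun σ d => ?_, (parts μ).degree, fun d h => ?_⟩
  · rw [coeff_mSym, coeff_mSym]
    congr 1
    refine propext ⟨?_, ?_⟩
    · rintro ⟨τ, hτ⟩
      refine ⟨σ⁻¹ * τ, fun i => ?_⟩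
      rw [← hτ, Finsupp.equivMapDomain_apply]
      rfl
    · rintro ⟨τ, hτ⟩
      refine ⟨σ * τ, fun i => ?_⟩
      rw [← hτ, Finsupp.equivMapDomain_apply, Equiv.Perm.mul_apply, Equiv.symm_apply_apply]
  · obtain ⟨σ, hσ⟩ := (coeff_mSym_ne_zero μ d).1 h
    have : d = Finsupp.mapDomain σ (parts μ) := by
      rw [← Finsupp.equivMapDomain_eq_mapDomain]
      ext i
      rw [Finsupp.equivMapDomain_apply, parts_apply, ← hσ, Equiv.apply_symm_apply]
    rw [this, Finsupp.degree_mapDomain]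

theorem exists_sorted (d : ℕ →₀ ℕ) :
    ∃ (μ : YoungDiagram) (σ : Equiv.Perm ℕ), ∀ i, d (σ i) = μ.rowLen i := by
  classical
  obtain ⟨n, hn⟩ : ∃ n, d.support ⊆ Finset.range n :=
    ⟨d.support.sup id + 1, fun i hi => Finset.mem_range.2
      (Nat.lt_succ_of_le (Finset.le_sup (f := id) hi))⟩
  let f : Fin n → ℕᵒᵈ := fun i => OrderDual.toDual (d i)
  let s := Tuple.sort f
  have hs : Monotone (f ∘ s) := Tuple.monotone_sort f
  obtain ⟨σ, _, hσ⟩ := perm_extend (fun _ => True) trivial (fun _ _ _ _ => trivial)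
    (Finset.range n) (fun i => if h : i < n then s ⟨i, h⟩ else 0) (by
      intro i hi j hj hij
      simp only [Finset.coe_range, Set.mem_Iio] at hi hj
      simp only [hi, hj, dif_pos] at hij
      simpa using s.injective (Fin.ext hij))
  have hσn : ∀ i (h : i < n), σ i = s ⟨i, h⟩ := fun i h => by
    rw [hσ i (Finset.mem_range.2 h), dif_pos h]
  have hzero : ∀ i, n ≤ i → d (σ i) = 0 := by
    intro i hi
    by_contra h0
    have hlt := Finset.mem_range.1 (hn (Finsupp.mem_support_iff.2 h0))
    have h1 := hσn (s.symm ⟨σ i, hlt⟩ : Fin n) (Fin.is_lt _)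
    simp only [Fin.eta, Equiv.apply_symm_apply] at h1
    have := σ.injective h1
    have h2 := (s.symm ⟨σ i, hlt⟩).is_lt
    omega
  have hanti : ∀ i j, i ≤ j → d (σ j) ≤ d (σ i) := by
    intro i j hij
    by_cases hj : j < n
    · have hi : i < n := by omega
      rw [hσn i hi, hσn j hj]
      exact hs (show (⟨i, hi⟩ : Fin n) ≤ ⟨j, hj⟩ from hij)
    · rw [hzero j (by omega)]
      exact Nat.zero_le _
  let μ : YoungDiagram :=
    { cells := (Finset.range n ×ˢ Finset.range (d (σ 0))).filter fun c => c.2 < d (σ c.1)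
      isLowerSet := by
        rintro ⟨i, j⟩ ⟨i', j'⟩ ⟨h1, h2⟩ h
        simp only [Finset.coe_filter, Finset.mem_product, Finset.mem_range,
          Set.mem_ofPred_eq] at h ⊢
        simp only at h1 h2
        have := hanti _ _ h1
        omega }
  refine ⟨μ, σ, fun i => cnt_ext fun j => ?_⟩
  rw [← YoungDiagram.mem_iff_lt_rowLen, ← YoungDiagram.mem_cells]
  simp only [μ, Finset.mem_filter, Finset.mem_product, Finset.mem_range]
  constructor
  · intro h
    have h1 := hanti 0 i (Nat.zero_le _)
    have h2 : i < n := by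
      by_contra! h2
      have := hzero i h2
      omega
    omega
  · exact fun h => h.2

/-- `Λ_ℕ` is the `ℕ`-span of the monomial symmetric functions. -/
theorem mem_LambdaN_iff (f : MvPowerSeries ℕ ℕ) :
    f ∈ LambdaN ↔ f ∈ Submodule.span ℕ (Set.range mSym) := by
  classical
  constructor
  · intro hf
    obtain ⟨N, hN⟩ := hf.2
    have hinj : Function.Injective parts := by
      intro μ ν h
      by_contra hne
      have h1 := coeff_parts_mSym μ ν
      rw [h, coeff_parts_mSym, if_pos rfl, if_neg hne] at h1
      omega
    have hfin : {μ : YoungDiagram | MvPowerSeries.coeff (parts μ) f ≠ 0}.Finite := by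
      refine Set.Finite.subset ((finite_restrict N ⟨f, hf⟩).preimage hinj.injOn) fun μ hμ => ?_
      refine ⟨fun i hi => ?_, hμ⟩
      have h1 := hN _ hμ
      have h2 : (parts μ).support.card ≤ (parts μ).degree := by
        rw [Finsupp.degree_apply, Finset.card_eq_sum_ones]
        exact Finset.sum_le_sum fun j hj => Nat.one_le_iff_ne_zero.2 (Finsupp.mem_support_iff.1 hj)
      have h3 : Finset.range (i + 1) ⊆ (parts μ).support := by
        intro j hj
        rw [Finsupp.mem_support_iff, parts_apply] at hi ⊢
        have := μ.rowLen_anti j i (by simpa [Nat.lt_succ_iff] using hj)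
        omega
      have h4 := Finset.card_le_card h3
      rw [Finset.card_range] at h4
      exact Finset.mem_range.2 (by omega)
    have : f = ∑ μ ∈ hfin.toFinset, MvPowerSeries.coeff (parts μ) f • mSym μ := by
      ext d
      obtain ⟨ν, σ, hσ⟩ := exists_sorted d
      have hd : ∀ g ∈ LambdaN, MvPowerSeries.coeff d g = MvPowerSeries.coeff (parts ν) g :=
        fun g hg => coeff_perm hg σ hσ
      rw [hd f hf, map_sum]
      have : ∀ μ ∈ hfin.toFinset, MvPowerSeries.coeff d
          (MvPowerSeries.coeff (parts μ) f • mSym μ) =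
          if ν = μ then MvPowerSeries.coeff (parts μ) f else 0 := by
        intro μ _
        rw [map_nsmul, hd _ (mSym_mem_LambdaN μ), coeff_parts_mSym]
        simp
      rw [Finset.sum_congr rfl this, Finset.sum_ite_eq]
      split_ifs with h
      · rfl
      · simpa using h
    rw [this]
    exact Submodule.sum_mem _ fun μ _ =>
      Submodule.smul_mem _ _ (Submodule.subset_span ⟨μ, rfl⟩)
  · intro hf
    induction hf using Submodule.span_induction with
    | mem f h =>
      obtain ⟨μ, rfl⟩ := h
      exact mSym_mem_LambdaN μ
    | zero => exact LambdaN.zero_mem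
    | add f g _ _ hf hg => exact LambdaN.add_mem hf hg
    | smul n f _ hf => exact LambdaN.nsmul_mem hf n

open Classical in
theorem pairWitt_mSym (x y : ℕ) (μ : YoungDiagram) :
    pairWitt x y ⟨mSym μ, mSym_mem_LambdaN μ⟩ = if y + 1 ≤ μ.rowLen x then 0 else 1 := by
  have h1 : Survives x y (mSym μ) ↔ ¬ y + 1 ≤ μ.rowLen x := by
    have h2 : μ.colLen y ≤ x ↔ ¬ y + 1 ≤ μ.rowLen x := by
      rw [Nat.succ_le_iff, ← YoungDiagram.mem_iff_lt_rowLen, YoungDiagram.mem_iff_lt_colLen, not_lt]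
    rw [← h2]
    constructor
    · rintro ⟨d, hd, hx⟩
      obtain ⟨σ, hσ⟩ := (coeff_mSym_ne_zero μ d).1 hd
      rwa [card_bigRows hσ] at hx
    · intro h
      refine ⟨parts μ, (coeff_mSym_ne_zero μ _).2 ⟨1, fun _ => rfl⟩, ?_⟩
      rwa [bigRows_parts, Finset.card_range]
  change (if Survives x y (mSym μ) then (1 : BB) else 0) = _
  by_cases h : y + 1 ≤ μ.rowLen x <;> simp [h1, h]

instance finite_tableaux (μ : YoungDiagram) (d : ℕ →₀ ℕ) :
    Finite {T : SemistandardYoungTableau μ // ∀ k, content T k = d k} := by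
  have hT : ∀ (T : {T : SemistandardYoungTableau μ // ∀ k, content T k = d k}) (c : μ.cells),
      T.1 c.1.1 c.1.2 ∈ d.support := by
    rintro ⟨T, hT⟩ ⟨c, hc⟩
    have hmem : c ∈ μ.cells.filter fun c' => T c'.1 c'.2 = T c.1 c.2 :=
      Finset.mem_filter.2 ⟨hc, rfl⟩
    rw [Finsupp.mem_support_iff, ← hT]
    exact (Finset.card_pos.2 ⟨c, hmem⟩).ne'
  refine Finite.of_injective (β := μ.cells → d.support)
    (fun T c => ⟨T.1 c.1.1 c.1.2, hT T c⟩) fun T T' h => Subtype.ext ?_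
  ext i j
  by_cases hij : (i, j) ∈ μ
  · have := congrArg Subtype.val (congrFun h ⟨(i, j), hij⟩)
    exact this
  · rw [T.1.zeros hij, T'.1.zeros hij]

theorem schur_ne_zero (μ : YoungDiagram) : schur μ ≠ 0 := by
  intro h
  let T := SemistandardYoungTableau.highestWeight μ
  let d : ℕ →₀ ℕ := Finsupp.onFinset (μ.cells.image fun c => T c.1 c.2) (content T) (by
    intro k hk
    obtain ⟨c, hc⟩ := Finset.card_pos.1 (Nat.pos_of_ne_zero hk)
    exact Finset.mem_image.2 ⟨c, Finset.mem_filter.1 hc⟩)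
  have h1 : MvPowerSeries.coeff d (schur μ) ≠ 0 := by
    rw [coeff_schur]
    exact Nat.card_ne_zero.2 ⟨⟨⟨T, fun _ => rfl⟩⟩, inferInstance⟩
  exact h1 (by rw [h, map_zero])

/-- The map `ℕ² ∪ {∞} → W(𝔹)`; here `none` stands for `∞`, which sends every `m_μ` to `1`. -/
def wittCoord : Option (ℕ × ℕ) → Witt BB
  | none => nonzeroHom LambdaN
  | some (x, y) => pairWitt x y

theorem wittCoord_none_mSym (μ : YoungDiagram) :
    wittCoord none ⟨mSym μ, mSym_mem_LambdaN μ⟩ = 1 := by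
  refine if_neg fun h => ?_
  have h1 := congrArg (MvPowerSeries.coeff (parts μ)) (congrArg Subtype.val h)
  exact (coeff_mSym_ne_zero μ _).2 ⟨1, fun _ => rfl⟩ h1

/-- The element `∞` of `W^Sch(𝔹)`, which sends every `s_μ` to `1`. -/
def inftySch : WittSch BB := nonzeroHom LambdaSch

theorem inftySch_schur (μ : YoungDiagram) : inftySch ⟨schur μ, schur_mem_LambdaSch μ⟩ = 1 :=
  if_neg fun h => schur_ne_zero μ (congrArg Subtype.val h)

end

end BoolWitt

/-! All coefficients are natural numbers and $1+1=1$ in $\mathbf B$, so a homomorphism $\varphi$ on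
$\Lambda_{\mathbf N}$ amounts to a permutation-invariant set $D$ of surviving exponent vectors:
$\varphi(f)=1$ exactly when some monomial of $f$ lies in $D$ (`witt_eq_one_iff`). Multiplicativity
gives two properties. $D$ is closed downwards, since $x^d$ occurs in $m_e m_{d-e}$
(`witt_orbitSum_of_le`); and for $d,e\in D$ some sum of a rearrangement of $d$ and one of $e$ lies
in $D$ (`witt_orbitSum_mul`).

If $D$ is not everything, it misses a rectangle. Let $x+1$ be the least number of rows, and $y+1$
the least number of columns, of a missing rectangle. Then $D$ is the set of vectors with at most $x$
entries greater than $y$. For one inclusion, if the $(x+1)\times(y+1)$ rectangle survived, its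
powers would yield surviving vectors whose degree is too large for the bounds imposed by the missing
rectangles (`witt_rect_ne_one`). For the other, a tall rectangle with $x$ rows and a long one with
$y$ columns both survive, and every term of their product dominates a rearrangement of the given
vector (`witt_of_card_bigRows_le`). Rectangular $m_\lambda$ separate the pairs.

On the Schur side everything is read off from the contents of tableaux. A tableau with distinct
entries gives a squarefree monomial, which survives as soon as $y\ge1$. For $y=0$, survival means
that at most $x$ variables occur, which is the nonvanishing of $f(1,\dots,1,0,\dots)$ with $x$ ones.
-/

namespace BoolWitt

/-! ### Arithmetic of the Boolean semiring. -/

theorem BB.eq_zero_or_one (a : BB) : a = 0 ∨ a = 1 := by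
  cases a
  · exact Or.inl rfl
  · exact Or.inr rfl

theorem BB.add_eq_one {a b : BB} : a + b = 1 ↔ a = 1 ∨ b = 1 := by
  rcases a.eq_zero_or_one with rfl | rfl
  · simp [BB.zero_ne_one]
  · simp [BB.one_add]

theorem BB.mul_eq_one {a b : BB} : a * b = 1 ↔ a = 1 ∧ b = 1 := by
  rcases a.eq_zero_or_one with rfl | rfl
  · simp [BB.zero_ne_one]
  · simp

/-- Reduces an equality of homomorphisms into $\mathbf B$ to a comparison of the sets on which they
take the value $1$. -/
theorem BB.ext_one {a b : BB} (h : a = 1 ↔ b = 1) : a = b := by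
  rcases a.eq_zero_or_one with rfl | rfl
  · rcases b.eq_zero_or_one with rfl | rfl
    · rfl
    · exact h.2 rfl
  · exact (h.1 rfl).symm

theorem BB.natCast_eq_one {n : ℕ} : (n : BB) = 1 ↔ n ≠ 0 := by
  cases n with
  | zero => simp [BB.zero_ne_one]
  | succ n => simp [BB.add_one]

/-! ### Orbit sums and the set of surviving monomials. -/

noncomputable section

/-- The sum of all distinct permutations of the monomial `x^d`. -/
def orbitSum (d : ℕ →₀ ℕ) : LambdaN :=
  ⟨mSym (exists_sorted d).choose, mSym_mem_LambdaN _⟩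

theorem orbitSum_eq {d : ℕ →₀ ℕ} {μ : YoungDiagram} {σ : Equiv.Perm ℕ}
    (h : ∀ i, d (σ i) = μ.rowLen i) : orbitSum d = ⟨mSym μ, mSym_mem_LambdaN μ⟩ := by
  obtain ⟨τ, hτ⟩ := (exists_sorted d).choose_spec
  refine Subtype.ext ?_
  change mSym _ = mSym μ
  congr 1
  exact eq_of_colLen fun y => by rw [← card_bigRows hτ, ← card_bigRows h]

theorem orbitSum_parts (μ : YoungDiagram) :
    orbitSum (parts μ) = ⟨mSym μ, mSym_mem_LambdaN μ⟩ :=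
  orbitSum_eq (σ := 1) fun _ => rfl

theorem coeff_orbitSum_ne_zero (d e : ℕ →₀ ℕ) :
    MvPowerSeries.coeff e (orbitSum d : MvPowerSeries ℕ ℕ) ≠ 0 ↔
      ∃ σ : Equiv.Perm ℕ, ∀ i, e (σ i) = d i := by
  obtain ⟨μ, τ, hτ⟩ := exists_sorted d
  rw [orbitSum_eq hτ, coeff_mSym_ne_zero]
  constructor
  · rintro ⟨σ, hσ⟩
    refine ⟨σ * τ⁻¹, fun i => ?_⟩
    rw [Equiv.Perm.mul_apply, hσ, ← hτ, ← Equiv.Perm.mul_apply, mul_inv_cancel]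
    rfl
  · rintro ⟨σ, hσ⟩
    exact ⟨σ * τ, fun i => by rw [Equiv.Perm.mul_apply, hσ, hτ]⟩

theorem coeff_orbitSum_self (d : ℕ →₀ ℕ) :
    MvPowerSeries.coeff d (orbitSum d : MvPowerSeries ℕ ℕ) ≠ 0 :=
  (coeff_orbitSum_ne_zero d d).2 ⟨1, fun _ => rfl⟩

theorem orbitSum_perm {d e : ℕ →₀ ℕ} {σ : Equiv.Perm ℕ} (h : ∀ i, e (σ i) = d i) :
    orbitSum e = orbitSum d := by
  obtain ⟨μ, τ, hτ⟩ := exists_sorted d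
  rw [orbitSum_eq hτ]
  exact orbitSum_eq (σ := σ * τ) fun i => by rw [Equiv.Perm.mul_apply, h, hτ]

/-- A Boolean Witt vector is determined by the monomials whose orbit sums it does not kill. -/
theorem witt_eq_one_iff (φ : Witt BB) (f : LambdaN) : φ f = 1 ↔
    ∃ d, MvPowerSeries.coeff d (f : MvPowerSeries ℕ ℕ) ≠ 0 ∧ φ (orbitSum d) = 1 := by
  obtain ⟨f, hf⟩ := f
  have hspan := (mem_LambdaN_iff f).1 hf
  revert hf
  -- Over $\mathbf N$ the span is the additive closure, so only sums of $m_\mu$ need treatment and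
  -- scalars disappear.
  rw [← Submodule.mem_toAddSubmonoid, Submodule.span_nat_eq_addSubmonoidClosure] at hspan
  induction hspan using AddSubmonoid.closure_induction with
  | mem f h =>
    obtain ⟨μ, rfl⟩ := h
    intro hf
    constructor
    · intro h
      refine ⟨parts μ, (coeff_mSym_ne_zero μ _).2 ⟨1, fun _ => rfl⟩, ?_⟩
      rwa [orbitSum_parts]
    · rintro ⟨d, hd, h⟩
      obtain ⟨σ, hσ⟩ := (coeff_mSym_ne_zero μ d).1 hd
      rwa [orbitSum_eq hσ] at h
  | zero =>
    intro hf
    rw [show (⟨0, hf⟩ : LambdaN) = 0 from rfl, map_zero]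
    simp [BB.zero_ne_one]
  | add f g hf' hg' ihf ihg =>
    intro hfg
    rw [← Submodule.span_nat_eq_addSubmonoidClosure, Submodule.mem_toAddSubmonoid,
      ← mem_LambdaN_iff] at hf' hg'
    rw [show (⟨f + g, hfg⟩ : LambdaN) = ⟨f, hf'⟩ + ⟨g, hg'⟩ from rfl, map_add, BB.add_eq_one]
    refine (or_congr (ihf hf') (ihg hg')).trans ?_
    rw [← exists_or]
    refine exists_congr fun d => ?_
    rw [← or_and_right]
    refine and_congr_left fun _ => ?_
    rw [Subsemiring.coe_add, map_add]
    dsimp only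
    omega

theorem coeff_mul_ne_zero {f g : MvPowerSeries ℕ ℕ} {c : ℕ →₀ ℕ}
    (h : MvPowerSeries.coeff c (f * g) ≠ 0) :
    ∃ a b, a + b = c ∧ MvPowerSeries.coeff a f ≠ 0 ∧ MvPowerSeries.coeff b g ≠ 0 := by
  classical
  rw [MvPowerSeries.coeff_mul] at h
  obtain ⟨⟨a, b⟩, hab, hne⟩ := Finset.exists_ne_zero_of_sum_ne_zero h
  exact ⟨a, b, Finset.HasAntidiagonal.mem_antidiagonal.1 hab,
    left_ne_zero_of_mul hne, right_ne_zero_of_mul hne⟩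

theorem orbitSum_zero : orbitSum 0 = 1 := by
  classical
  refine Subtype.ext ?_
  have h0 : (0 : ℕ →₀ ℕ) = parts ⊥ := by
    ext i
    rw [parts_apply, Finsupp.zero_apply]
    symm
    by_contra h
    exact YoungDiagram.notMem_bot (i, 0)
      (YoungDiagram.mem_iff_lt_rowLen.2 (Nat.pos_of_ne_zero h))
  ext d
  obtain ⟨μ, σ, hσ⟩ := exists_sorted d
  -- Both sides are symmetric, so it suffices to compare coefficients at sorted exponent vectors.
  rw [coeff_perm (orbitSum 0).2 σ hσ (d := parts μ), coeff_perm (1 : LambdaN).2 σ hσ (d := parts μ),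
    h0, orbitSum_parts, coeff_parts_mSym, Subsemiring.coe_one, MvPowerSeries.coeff_one, h0]
  have : parts μ = parts ⊥ ↔ μ = ⊥ := by
    refine ⟨fun h => eq_of_colLen fun y => ?_, fun h => by rw [h]⟩
    rw [← Finset.card_range (μ.colLen y), ← bigRows_parts, h, bigRows_parts, Finset.card_range]
  simp only [this]

/-! ### Closure properties of the surviving monomials. -/

section Orbits

variable {φ : Witt BB}

/-- The monomial $x^d$ occurs in $m_e m_{d-e}$, so this product is not killed, and hence neither
factor is. -/
theorem witt_orbitSum_of_le {d e : ℕ →₀ ℕ} (h : e ≤ d) (hd : φ (orbitSum d) = 1) :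
    φ (orbitSum e) = 1 := by
  have h1 : φ (orbitSum e * orbitSum (d - e)) = 1 := by
    refine (witt_eq_one_iff φ _).2 ⟨d, ?_, hd⟩
    have := coeff_add_mul_ne_zero (coeff_orbitSum_self e) (coeff_orbitSum_self (d - e))
    rwa [add_tsub_cancel_of_le h] at this
  rw [map_mul, BB.mul_eq_one] at h1
  exact h1.1

/-- Domination up to rearrangement: the injection on the support extends to a permutation, which
moves $d$ below $e$. -/
theorem witt_orbitSum_of_injOn {d e : ℕ →₀ ℕ} (f : ℕ → ℕ) (hf : Set.InjOn f d.support)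
    (h : ∀ i ∈ d.support, d i ≤ e (f i)) (he : φ (orbitSum e) = 1) : φ (orbitSum d) = 1 := by
  obtain ⟨σ, _, hσ⟩ := perm_extend (fun _ => True) trivial (fun _ _ _ _ => trivial) d.support f hf
  have hle : Finsupp.equivMapDomain σ d ≤ e := by
    intro j
    obtain ⟨i, rfl⟩ := σ.surjective j
    rw [Finsupp.equivMapDomain_apply, Equiv.symm_apply_apply]
    by_cases hi : i ∈ d.support
    · rw [hσ i hi]
      exact h i hi
    · rw [Finsupp.notMem_support_iff.1 hi]
      exact Nat.zero_le _
  rw [← orbitSum_perm (σ := σ) (e := Finsupp.equivMapDomain σ d) fun i => by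
    rw [Finsupp.equivMapDomain_apply, Equiv.symm_apply_apply]]
  exact witt_orbitSum_of_le hle he

/-- The product of two surviving orbit sums has value $1$, so one of its monomials survives; nothing
is said about which one. -/
theorem witt_orbitSum_mul {d e : ℕ →₀ ℕ} (hd : φ (orbitSum d) = 1) (he : φ (orbitSum e) = 1) :
    ∃ a b : ℕ →₀ ℕ, (∃ σ : Equiv.Perm ℕ, ∀ i, a (σ i) = d i) ∧
      (∃ σ : Equiv.Perm ℕ, ∀ i, b (σ i) = e i) ∧ φ (orbitSum (a + b)) = 1 := by
  have h1 : φ (orbitSum d * orbitSum e) = 1 := by rw [map_mul, hd, he, one_mul]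
  obtain ⟨c, hc, hφ⟩ := (witt_eq_one_iff φ _).1 h1
  obtain ⟨a, b, rfl, ha, hb⟩ := coeff_mul_ne_zero hc
  exact ⟨a, b, (coeff_orbitSum_ne_zero _ _).1 ha, (coeff_orbitSum_ne_zero _ _).1 hb, hφ⟩

/-! ### Rectangular exponent vectors. -/

/-- The exponent vector `(b, …, b, 0, 0, …)` with `a` entries equal to `b`. -/
def rect (a b : ℕ) : ℕ →₀ ℕ :=
  Finsupp.onFinset (Finset.range a) (fun i => if i < a then b else 0) fun i hi => by
    rw [Finset.mem_range]
    by_contra h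
    exact hi (if_neg h)

theorem rect_apply (a b i : ℕ) : rect a b i = if i < a then b else 0 := rfl

theorem rect_zero_left (b : ℕ) : rect 0 b = 0 := by
  ext i
  simp [rect_apply]

theorem rect_zero_right (a : ℕ) : rect a 0 = 0 := by
  ext i
  simp [rect_apply]

theorem support_rect_subset (a b : ℕ) : (rect a b).support ⊆ Finset.range a :=
  Finsupp.support_onFinset_subset

theorem degree_rect (a b : ℕ) : (rect a b).degree = a * b := by
  rw [Finsupp.degree_apply, Finset.sum_subset (support_rect_subset a b)
    fun i _ h => Finsupp.notMem_support_iff.1 h]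
  rw [Finset.sum_congr rfl fun i hi => (rect_apply a b i).trans (if_pos (Finset.mem_range.1 hi))]
  simp

theorem exists_injOn_of_card_le {S T : Finset ℕ} (h : S.card ≤ T.card) :
    ∃ f : ℕ → ℕ, Set.InjOn f S ∧ ∀ i ∈ S, f i ∈ T := by
  have hcard : Fintype.card S ≤ Fintype.card T := by simpa using h
  obtain ⟨φ⟩ := Function.Embedding.nonempty_of_card_le hcard
  refine ⟨fun i => if hi : i ∈ S then φ ⟨i, hi⟩ else 0, fun i hi j hj hij => ?_, fun i hi => ?_⟩
  · simp only [Finset.mem_coe.1 hi, Finset.mem_coe.1 hj, dif_pos] at hij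
    simpa using φ.injective (Subtype.ext hij)
  · simp only [hi, dif_pos]
    exact (φ ⟨i, hi⟩).2

/-- Used in contrapositive form: a killed rectangle bounds the number of large entries of every
surviving vector. Entries greater than $b$ are at least $b+1$, whence the width of the rectangle. -/
theorem witt_rect_of_le_card {d : ℕ →₀ ℕ} {a b : ℕ} (h : a ≤ (bigRows b d).card)
    (hd : φ (orbitSum d) = 1) : φ (orbitSum (rect a (b + 1))) = 1 := by
  obtain ⟨f, hf, hmem⟩ := exists_injOn_of_card_le (S := Finset.range a)
    (T := bigRows b d) (by rwa [Finset.card_range])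
  refine witt_orbitSum_of_injOn f (hf.mono (support_rect_subset a _)) (fun i hi => ?_) hd
  have hi := support_rect_subset _ _ hi
  rw [rect_apply, if_pos (Finset.mem_range.1 hi)]
  exact mem_bigRows.1 (hmem i hi)

theorem degree_eq_of_perm {d e : ℕ →₀ ℕ} {σ : Equiv.Perm ℕ} (h : ∀ i, e (σ i) = d i) :
    e.degree = d.degree := by
  have : e = Finsupp.mapDomain σ d := by
    rw [← Finsupp.equivMapDomain_eq_mapDomain]
    ext i
    rw [Finsupp.equivMapDomain_apply, ← h, Equiv.apply_symm_apply]
  rw [this, Finsupp.degree_mapDomain]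

/-- A surviving monomial of the $k$-th power of a rectangular orbit sum. It is a sum of $k$
rearranged rectangles, so its degree is known and each entry is $b$ times the number of rectangles
covering that position. -/
theorem witt_rect_pow {a b : ℕ} (h : φ (orbitSum (rect a b)) = 1) (k : ℕ) :
    ∃ d : ℕ →₀ ℕ, φ (orbitSum d) = 1 ∧ d.degree = k * (a * b) ∧
      ∀ i, b ∣ d i ∧ d i ≤ k * b := by
  induction k with
  | zero => exact ⟨0, by rw [orbitSum_zero, map_one], by simp, by simp⟩
  | succ k ih =>
    obtain ⟨d, hd, hdeg, hdi⟩ := ih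
    obtain ⟨p, q, ⟨σ, hσ⟩, ⟨τ, hτ⟩, hpq⟩ := witt_orbitSum_mul hd h
    refine ⟨p + q, hpq, ?_, fun i => ?_⟩
    · rw [map_add, degree_eq_of_perm hσ, degree_eq_of_perm hτ, hdeg, degree_rect, add_mul, one_mul]
    · have h1 : p i = d (σ.symm i) := by rw [← hσ, Equiv.apply_symm_apply]
      have h2 : q i = rect a b (τ.symm i) := by rw [← hτ, Equiv.apply_symm_apply]
      have h3 : b ∣ rect a b (τ.symm i) ∧ rect a b (τ.symm i) ≤ b := by
        rw [rect_apply]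
        split_ifs <;> simp
      rw [Finsupp.add_apply, h1, h2, add_mul, one_mul]
      exact ⟨dvd_add (hdi _).1 h3.1, add_le_add (hdi _).2 h3.2⟩

/-- At most $x$ entries exceed $N$, each contributing at most $B$ beyond a basic allowance of $N$
for every element of the support. -/
theorem degree_le_of_card_bigRows {d : ℕ →₀ ℕ} {x M N B : ℕ} (hM : d.support.card ≤ M)
    (hx : (bigRows N d).card ≤ x) (hB : ∀ i, d i ≤ B) : d.degree ≤ x * B + M * N := by
  classical
  have h1 : ∀ i ∈ d.support, d i ≤ (if i ∈ bigRows N d then B else 0) + N := by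
    intro i _
    split_ifs with h
    · exact (hB i).trans (Nat.le_add_right _ _)
    · rw [mem_bigRows] at h
      omega
  rw [Finsupp.degree_apply]
  refine (Finset.sum_le_sum h1).trans ?_
  rw [Finset.sum_add_distrib, ← Finset.sum_filter, Finset.sum_const, Finset.sum_const,
    smul_eq_mul, smul_eq_mul]
  refine add_le_add (Nat.mul_le_mul_right _ (le_trans (Finset.card_le_card ?_) hx))
    (Nat.mul_le_mul_right _ hM)
  exact fun i hi => (Finset.mem_filter.1 hi).2

/-- If the rectangles with `x + 1` rows are eventually killed, and so are those with `y + 1`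
columns, then the rectangle with `x + 1` rows and `y + 1` columns is killed. -/
theorem witt_rect_ne_one {x y M N : ℕ} (hN : φ (orbitSum (rect (x + 1) N)) ≠ 1)
    (hM : φ (orbitSum (rect M (y + 1))) ≠ 1) : φ (orbitSum (rect (x + 1) (y + 1))) ≠ 1 := by
  intro h
  -- A rectangle of width $0$ has orbit sum $1$ and survives. After the shift, the killed width is
  -- $N+1$, so at most $x$ entries of a surviving vector exceed $N$.
  obtain ⟨N, rfl⟩ : ∃ n, N = n + 1 := by
    refine Nat.exists_eq_succ_of_ne_zero fun h0 => hN ?_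
    rw [h0, rect_zero_right, orbitSum_zero, map_one]
  -- For $k=MN+1$ the degree $k(x+1)(y+1)$ exceeds the bound $xk(y+1)+MN$ obtained below, because
  -- $k(y+1)\ge k>MN$.
  obtain ⟨d, hd, hdeg, hdi⟩ := witt_rect_pow h (M * N + 1)
  have h1 : (bigRows y d).card < M := by
    by_contra! h'
    exact hM (witt_rect_of_le_card h' hd)
  have h2 : (bigRows N d).card ≤ x := by
    by_contra! h'
    exact hN (witt_rect_of_le_card h' hd)
  -- Entries are multiples of $y+1$, so every nonzero one exceeds $y$; hence the support has fewer
  -- than $M$ elements.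
  have h3 : d.support ⊆ bigRows y d := fun i hi => mem_bigRows.2
    (Nat.le_of_dvd (Nat.pos_of_ne_zero (Finsupp.mem_support_iff.1 hi)) (hdi i).1)
  have h4 := degree_le_of_card_bigRows ((Finset.card_le_card h3).trans h1.le) h2 fun i => (hdi i).2
  rw [hdeg, show (M * N + 1) * ((x + 1) * (y + 1)) =
    x * ((M * N + 1) * (y + 1)) + (M * N + 1) * (y + 1) by ring] at h4
  have h5 := Nat.le_mul_of_pos_right (M * N + 1) (show 0 < y + 1 by omega)
  omega

theorem exists_eq_of_perm_rect {a : ℕ →₀ ℕ} {σ : Equiv.Perm ℕ} {n b : ℕ}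
    (h : ∀ i, a (σ i) = rect n b i) : ∃ S : Finset ℕ, S.card = n ∧ ∀ i ∈ S, a i = b := by
  refine ⟨(Finset.range n).map σ.toEmbedding, by simp, fun i hi => ?_⟩
  obtain ⟨j, hj, rfl⟩ := Finset.mem_map.1 hi
  exact (h j).trans (if_pos (Finset.mem_range.1 hj))

/-- In any term of the product of the two rectangles, the $x$ tall rows accommodate the entries of
$d$ greater than $y$, and enough rows of height at least $y$ remain elsewhere for the others. -/
theorem witt_of_card_bigRows_le {x y : ℕ} (hx : ∀ N, φ (orbitSum (rect x N)) = 1)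
    (hy : ∀ M, φ (orbitSum (rect M y)) = 1) {d : ℕ →₀ ℕ} (hd : (bigRows y d).card ≤ x) :
    φ (orbitSum d) = 1 := by
  classical
  obtain ⟨a, b, ⟨σ, hσ⟩, ⟨τ, hτ⟩, hab⟩ :=
    -- The height `d.degree` bounds every entry of $d$. The extra $x$ rows of the second rectangle
    -- allow for overlap with the first.
    witt_orbitSum_mul (hx d.degree) (hy (d.support.card + x))
  obtain ⟨P, hP, haP⟩ := exists_eq_of_perm_rect hσ
  obtain ⟨Q, hQ, hbQ⟩ := exists_eq_of_perm_rect hτ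
  obtain ⟨f, hf, hfP⟩ := exists_injOn_of_card_le (hd.trans_eq hP.symm)
  have hQP : d.support.card ≤ (Q \ P).card := by
    have := Finset.le_card_sdiff P Q
    omega
  obtain ⟨g, hg, hgQ⟩ := exists_injOn_of_card_le hQP
  refine witt_orbitSum_of_injOn (fun i => if i ∈ bigRows y d then f i else g i) ?_ ?_ hab
  · intro i hi j hj hij
    have hgi := Finset.mem_sdiff.1 (hgQ i hi)
    have hgj := Finset.mem_sdiff.1 (hgQ j hj)
    by_cases h1 : i ∈ bigRows y d <;> by_cases h2 : j ∈ bigRows y d <;>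
      simp only [h1, h2, if_true, if_false] at hij
    · exact hf h1 h2 hij
    · exact absurd (hij ▸ hfP i h1) hgj.2
    · exact absurd (hij ▸ hfP j h2) hgi.2
    · exact hg hi hj hij
  · intro i hi
    rw [Finsupp.add_apply]
    split_ifs with h
    · rw [haP _ (hfP i h)]
      exact (Finsupp.le_degree i d).trans (Nat.le_add_right _ _)
    · rw [hbQ _ (Finset.mem_sdiff.1 (hgQ i hi)).1]
      rw [mem_bigRows] at h
      omega

/-! ### Classification of the Boolean Witt vectors. -/

theorem le_rect (d : ℕ →₀ ℕ) : ∃ a b, d ≤ rect a b := by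
  refine ⟨d.support.sup id + 1, d.degree, fun i => ?_⟩
  rw [rect_apply]
  split_ifs with h
  · exact Finsupp.le_degree i d
  · by_contra! h0
    have : id i ≤ d.support.sup id := Finset.le_sup (Finsupp.mem_support_iff.2 h0.ne')
    simp only [id] at this
    omega

/-- A Boolean Witt vector either kills no monomial or is one of the pairs. -/
theorem witt_orbitSum_classification (φ : Witt BB) :
    (∀ d, φ (orbitSum d) = 1) ∨
      ∃ x y, ∀ d, φ (orbitSum d) = 1 ↔ (bigRows y d).card ≤ x := by
  classical
  rw [or_iff_not_imp_left]
  intro h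
  push Not at h
  obtain ⟨d, hd⟩ := h
  obtain ⟨A, B, hAB⟩ := le_rect d
  have hrect : φ (orbitSum (rect A B)) ≠ 1 := fun h => hd (witt_orbitSum_of_le hAB h)
  have h1 : ∃ a N, φ (orbitSum (rect a N)) ≠ 1 := ⟨A, B, hrect⟩
  have h2 : ∃ b M, φ (orbitSum (rect M b)) ≠ 1 := ⟨B, A, hrect⟩
  -- The least number of rows is positive because the rectangle without rows has orbit sum $1$;
  -- likewise for columns.
  obtain ⟨x, hx⟩ : ∃ x, Nat.find h1 = x + 1 := by
    refine Nat.exists_eq_succ_of_ne_zero fun h0 => ?_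
    obtain ⟨N, hN⟩ := Nat.find_spec h1
    rw [h0, rect_zero_left, orbitSum_zero, map_one] at hN
    exact hN rfl
  obtain ⟨y, hy⟩ : ∃ y, Nat.find h2 = y + 1 := by
    refine Nat.exists_eq_succ_of_ne_zero fun h0 => ?_
    obtain ⟨M, hM⟩ := Nat.find_spec h2
    rw [h0, rect_zero_right, orbitSum_zero, map_one] at hM
    exact hM rfl
  obtain ⟨N, hN⟩ := Nat.find_spec h1
  obtain ⟨M, hM⟩ := Nat.find_spec h2
  rw [hx] at hN
  rw [hy] at hM
  -- By minimality, all rectangles with $x$ rows survive, and so do all those with $y$ columns.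
  have hx' := Nat.find_min h1 (m := x) (by omega)
  have hy' := Nat.find_min h2 (m := y) (by omega)
  push Not at hx' hy'
  refine ⟨x, y, fun d => ⟨fun hd => ?_, witt_of_card_bigRows_le hx' hy'⟩⟩
  by_contra! hc
  exact witt_rect_ne_one hN hM (witt_rect_of_le_card hc hd)

end Orbits

/-! ### Bijectivity of the parametrization of $W(\mathbf B)$. -/

theorem pairWitt_eq_one_iff (x y : ℕ) (f : LambdaN) : pairWitt x y f = 1 ↔ Survives x y f := by
  classical
  change (if Survives x y f then (1 : BB) else 0) = 1 ↔ _
  by_cases h : Survives x y f <;> simp [h, BB.zero_ne_one]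

theorem nonzeroHom_eq_one_iff (S : Subsemiring (MvPowerSeries ℕ ℕ)) (f : S) :
    nonzeroHom S f = 1 ↔ f ≠ 0 := by
  classical
  change (if f = 0 then (0 : BB) else 1) = 1 ↔ _
  by_cases h : f = 0 <;> simp [h, BB.zero_ne_one]

theorem wittCoord_surjective : Function.Surjective wittCoord := by
  intro φ
  rcases witt_orbitSum_classification φ with h | ⟨x, y, h⟩
  · refine ⟨none, RingHom.ext fun f => BB.ext_one ?_⟩
    rw [witt_eq_one_iff φ, wittCoord, nonzeroHom_eq_one_iff, ← not_iff_not]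
    push Not
    simp only [h, ne_eq, not_true, imp_false, not_not]
    rw [Subtype.ext_iff, MvPowerSeries.ext_iff]
    simp
  · refine ⟨some (x, y), RingHom.ext fun f => BB.ext_one ?_⟩
    rw [witt_eq_one_iff φ, wittCoord, pairWitt_eq_one_iff]
    simp only [Survives, h]

/-- The Young diagram of the cells that are weakly above and to the left of `(x, y)`. -/
def rectDiagram (x y : ℕ) : YoungDiagram where
  cells := Finset.Iic (x, y)
  isLowerSet := by
    rw [Finset.coe_Iic]
    exact isLowerSet_Iic _

theorem lt_rowLen_rectDiagram {x y i j : ℕ} :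
    j + 1 ≤ (rectDiagram x y).rowLen i ↔ i ≤ x ∧ j ≤ y := by
  rw [Nat.succ_le_iff, ← YoungDiagram.mem_iff_lt_rowLen, ← YoungDiagram.mem_cells]
  exact Finset.mem_Iic

theorem wittCoord_injective : Function.Injective wittCoord := by
  classical
  -- The diagram has $x'+1$ rows and $y'+1$ columns, so $(x,y)$ kills it exactly when
  -- $(x,y)\le(x',y')$. The killed rectangles thus recover the pair, and $\infty$ kills none.
  have hval : ∀ x y x' y', wittCoord (some (x, y)) ⟨mSym (rectDiagram x' y'),
      mSym_mem_LambdaN _⟩ = if x ≤ x' ∧ y ≤ y' then 0 else 1 := by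
    intro x y x' y'
    rw [wittCoord, pairWitt_mSym]
    simp only [lt_rowLen_rectDiagram]
  have hnone : ∀ x y, wittCoord none ≠ wittCoord (some (x, y)) := by
    intro x y h
    have h1 := hval x y x y
    rw [← h, wittCoord_none_mSym, if_pos ⟨le_rfl, le_rfl⟩] at h1
    exact BB.zero_ne_one h1.symm
  have hle : ∀ x y x' y', wittCoord (some (x, y)) = wittCoord (some (x', y')) →
      x ≤ x' ∧ y ≤ y' := by
    intro x y x' y' h
    have h1 := hval x' y' x' y'
    rw [if_pos ⟨le_rfl, le_rfl⟩, ← h, hval] at h1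
    by_contra hc
    rw [if_neg hc] at h1
    exact BB.zero_ne_one h1.symm
  rintro (_ | ⟨x, y⟩) (_ | ⟨x', y'⟩) h
  · rfl
  · exact absurd h (hnone _ _)
  · exact absurd h.symm (hnone _ _)
  · have h1 := hle _ _ _ _ h
    have h2 := hle _ _ _ _ h.symm
    rw [le_antisymm h1.1 h2.1, le_antisymm h1.2 h2.2]

/-! ### Natural numbers in $W^{\mathrm{Sch}}(\mathbf B)$. -/

/-- The value is a sum of natural coefficients, so it is nonzero exactly when some monomial in the
first $x$ variables occurs. By symmetry, any monomial in at most $x$ variables can be moved there.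
-/
theorem evalOnes_ne_zero_iff (x : ℕ) (f : LambdaN) :
    evalOnes x f ≠ 0 ↔ Survives x 0 (f : MvPowerSeries ℕ ℕ) := by
  have h1 : evalOnes x f = ∑ d ∈ (finite_restrict x f).toFinset,
      MvPowerSeries.coeff d (f : MvPowerSeries ℕ ℕ) := by
    change MvPolynomial.eval _ (restrictFun x f) = _
    rw [restrictFun, map_sum]
    refine Finset.sum_congr rfl fun d _ => ?_
    rw [MvPolynomial.eval_monomial]
    simp
  have h2 : ∀ d : ℕ →₀ ℕ, bigRows 0 d = d.support := by
    intro d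
    ext i
    rw [mem_bigRows, Finsupp.mem_support_iff, Nat.pos_iff_ne_zero]
  rw [h1, ne_eq, Finset.sum_eq_zero_iff]
  constructor
  · intro h
    push Not at h
    obtain ⟨d, hd, hne⟩ := h
    rw [Set.Finite.mem_toFinset] at hd
    refine ⟨d, hne, ?_⟩
    rw [h2]
    simpa using Finset.card_le_card hd.1
  · rintro ⟨d, hd, hx⟩ h
    rw [h2] at hx
    -- Sorting the exponents moves the support to an initial segment without changing the
    -- coefficient.
    obtain ⟨μ, σ, hσ⟩ := exists_sorted d
    rw [coeff_perm f.2 σ (d := parts μ) hσ] at hd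
    refine hd (h (parts μ) ((Set.Finite.mem_toFinset _).2 ⟨?_, hd⟩))
    have h3 : (parts μ).support = Finset.range (μ.colLen 0) := by rw [← h2, bigRows_parts]
    rw [← h2, card_bigRows hσ] at hx
    rw [h3]
    exact Finset.range_subset_range.2 hx

theorem natSch_eq_one_iff (x : ℕ) (f : LambdaSch) :
    natSch BB x f = 1 ↔ Survives x 0 (f : MvPowerSeries ℕ ℕ) := by
  change ((evalOnes x (Subsemiring.inclusion LambdaSch_le f) : ℕ) : BB) = 1 ↔ _
  rw [BB.natCast_eq_one, evalOnes_ne_zero_iff]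
  rfl

theorem toSch_pairWitt_zero (x : ℕ) : toSch (pairWitt x 0) = natSch BB x := by
  refine RingHom.ext fun f => BB.ext_one ?_
  rw [natSch_eq_one_iff]
  exact pairWitt_eq_one_iff x 0 _

/-- Schur functions generate `LambdaSch` by definition, so the Littlewood-Richardson rule is not
needed. -/
theorem wittSch_ext {v w : WittSch BB}
    (h : ∀ μ, v ⟨schur μ, schur_mem_LambdaSch μ⟩ = w ⟨schur μ, schur_mem_LambdaSch μ⟩) :
    v = w := by
  refine RingHom.ext ?_
  rintro ⟨f, hf⟩
  unfold LambdaSch at hf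
  induction hf using Subsemiring.closure_induction with
  | mem f hf =>
    obtain ⟨μ, rfl⟩ := hf
    exact h μ
  | zero => exact (map_zero v).trans (map_zero w).symm
  | one => exact (map_one v).trans (map_one w).symm
  | add f g hf hg ihf ihg =>
    refine (map_add v ⟨f, hf⟩ ⟨g, hg⟩).trans (Eq.trans ?_ (map_add w ⟨f, hf⟩ ⟨g, hg⟩).symm)
    rw [ihf, ihg]
  | mul f g hf hg ihf ihg =>
    refine (map_mul v ⟨f, hf⟩ ⟨g, hg⟩).trans (Eq.trans ?_ (map_mul w ⟨f, hf⟩ ⟨g, hg⟩).symm)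
    rw [ihf, ihg]

/-! ### Surviving monomials of Schur functions. -/

/-- The exponent vector of a tableau. -/
def contentVec {μ : YoungDiagram} (T : SemistandardYoungTableau μ) : ℕ →₀ ℕ :=
  Finsupp.onFinset (μ.cells.image fun c => T c.1 c.2) (content T) fun k hk => by
    obtain ⟨c, hc⟩ := Finset.card_pos.1 (Nat.pos_of_ne_zero hk)
    exact Finset.mem_image.2 ⟨c, Finset.mem_filter.1 hc⟩

theorem contentVec_apply {μ : YoungDiagram} (T : SemistandardYoungTableau μ) (k : ℕ) :
    contentVec T k = content T k := rfl

/-- The coefficients count tableaux. Finiteness of the set counted matters, since `Nat.card` of an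
infinite type is $0$. -/
theorem survives_schur_iff (x y : ℕ) (μ : YoungDiagram) : Survives x y (schur μ) ↔
    ∃ T : SemistandardYoungTableau μ, (bigRows y (contentVec T)).card ≤ x := by
  constructor
  · rintro ⟨d, hd, hx⟩
    rw [coeff_schur] at hd
    obtain ⟨⟨T, hT⟩⟩ := (Nat.card_ne_zero.1 hd).1
    have : contentVec T = d := Finsupp.ext hT
    exact ⟨T, by rwa [this]⟩
  · rintro ⟨T, hT⟩
    refine ⟨contentVec T, ?_, hT⟩
    rw [coeff_schur]
    exact Nat.card_ne_zero.2 ⟨⟨⟨T, fun _ => rfl⟩⟩, inferInstance⟩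

/-- The tableau with pairwise distinct entries obtained by reading the rows one by one. -/
def rowReading (μ : YoungDiagram) : SemistandardYoungTableau μ where
  entry i j := if (i, j) ∈ μ then i * μ.rowLen 0 + j else 0
  row_weak' := by
    intro i j₁ j₂ hj hmem
    rw [if_pos hmem, if_pos (μ.up_left_mem le_rfl hj.le hmem)]
    omega
  col_strict' := by
    intro i₁ i₂ j hi hmem
    rw [if_pos hmem, if_pos (μ.up_left_mem hi.le le_rfl hmem)]
    have h0 := YoungDiagram.mem_iff_lt_rowLen.1 (μ.up_left_mem (Nat.zero_le _) le_rfl hmem)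
    have := Nat.mul_lt_mul_of_pos_right hi (show 0 < μ.rowLen 0 by omega)
    omega
  zeros' h := if_neg h

theorem rowReading_apply {μ : YoungDiagram} {i j : ℕ} (h : (i, j) ∈ μ) :
    rowReading μ i j = i * μ.rowLen 0 + j := if_pos h

theorem content_rowReading_le (μ : YoungDiagram) (k : ℕ) : content (rowReading μ) k ≤ 1 := by
  refine Finset.card_le_one.2 ?_
  rintro ⟨i, j⟩ h ⟨i', j'⟩ h'
  simp only [Finset.mem_filter, YoungDiagram.mem_cells] at h h'
  have h1 := YoungDiagram.mem_iff_lt_rowLen.1 (μ.up_left_mem (Nat.zero_le _) le_rfl h.1)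
  have h2 := YoungDiagram.mem_iff_lt_rowLen.1 (μ.up_left_mem (Nat.zero_le _) le_rfl h'.1)
  rw [rowReading_apply h.1] at h
  rw [rowReading_apply h'.1] at h'
  -- Column indices are less than `μ.rowLen 0`, so division with remainder by it recovers the cell
  -- from its entry.
  have hdiv : ∀ a b n : ℕ, b < n → (a * n + b) / n = a ∧ (a * n + b) % n = b := by
    intro a b n hb
    rw [mul_comm, Nat.mul_add_div (by omega), Nat.mul_add_mod, Nat.div_eq_of_lt hb,
      Nat.mod_eq_of_lt hb]
    exact ⟨rfl, rfl⟩
  have e1 := hdiv i j _ h1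
  have e2 := hdiv i' j' _ h2
  rw [h.2] at e1
  rw [h'.2] at e2
  rw [Prod.mk.injEq]
  omega

/-- A tableau with distinct entries contributes a squarefree monomial, which has no exponent greater
than $y\ge1$. -/
theorem survives_schur_of_pos {x y : ℕ} (hy : 1 ≤ y) (μ : YoungDiagram) :
    Survives x y (schur μ) := by
  refine (survives_schur_iff x y μ).2 ⟨rowReading μ, ?_⟩
  have : bigRows y (contentVec (rowReading μ)) = ∅ := by
    refine Finset.eq_empty_of_forall_notMem fun k hk => ?_
    have h1 := mem_bigRows.1 hk
    have h2 := content_rowReading_le μ k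
    rw [contentVec_apply] at h1
    omega
  rw [this]
  exact Nat.zero_le _

theorem content_pos_iff {μ : YoungDiagram} (T : SemistandardYoungTableau μ) (k : ℕ) :
    0 < content T k ↔ ∃ i j, (i, j) ∈ μ ∧ T i j = k := by
  rw [content, Finset.card_pos]
  constructor
  · rintro ⟨⟨i, j⟩, h⟩
    simp only [Finset.mem_filter, YoungDiagram.mem_cells] at h
    exact ⟨i, j, h⟩
  · rintro ⟨i, j, h⟩
    exact ⟨(i, j), Finset.mem_filter.2 ⟨(YoungDiagram.mem_cells _).2 h.1, h.2⟩⟩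

/-- The fewest distinct entries in a tableau equals the number of rows: column strictness forces
that many in the first column, and filling row $i$ with $i$ attains it. -/
theorem survives_zero_schur_iff (x : ℕ) (μ : YoungDiagram) :
    Survives x 0 (schur μ) ↔ ¬ 1 ≤ μ.rowLen x := by
  rw [survives_schur_iff]
  constructor
  · rintro ⟨T, hT⟩ h
    have hmem : ∀ i ≤ x, (i, 0) ∈ μ := fun i hi =>
      μ.up_left_mem hi le_rfl (YoungDiagram.mem_iff_lt_rowLen.2 h)
    have hinj : Set.InjOn (fun i => T i 0) (Finset.range (x + 1)) := by
      intro i hi j hj hij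
      simp only [Finset.coe_range, Set.mem_Iio] at hi hj
      by_contra hne
      rcases lt_or_gt_of_ne hne with hlt | hlt
      · exact (T.col_strict hlt (hmem j (by omega))).ne hij
      · exact (T.col_strict hlt (hmem i (by omega))).ne hij.symm
    have hsub : (Finset.range (x + 1)).image (fun i => T i 0) ⊆ bigRows 0 (contentVec T) := by
      intro k hk
      obtain ⟨i, hi, rfl⟩ := Finset.mem_image.1 hk
      rw [mem_bigRows, contentVec_apply, content_pos_iff]
      exact ⟨i, 0, hmem i (by have := Finset.mem_range.1 hi; omega), rfl⟩
    have := Finset.card_le_card hsub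
    rw [Finset.card_image_of_injOn hinj, Finset.card_range] at this
    omega
  · intro h
    refine ⟨SemistandardYoungTableau.highestWeight μ, ?_⟩
    have hsub : bigRows 0 (contentVec (SemistandardYoungTableau.highestWeight μ)) ⊆
        Finset.range x := by
      intro k hk
      rw [mem_bigRows, contentVec_apply, content_pos_iff] at hk
      obtain ⟨i, j, hij, hk⟩ := hk
      rw [SemistandardYoungTableau.highestWeight_apply, if_pos hij] at hk
      subst hk
      rw [Finset.mem_range]
      by_contra! hx
      exact h (lt_of_le_of_lt (Nat.zero_le _)
        (YoungDiagram.mem_iff_lt_rowLen.1 (μ.up_left_mem hx le_rfl hij)))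
    simpa using Finset.card_le_card hsub

/-! ### The natural map on the classified elements. -/

theorem toSch_wittCoord_of_pos (x : ℕ) {y : ℕ} (hy : 1 ≤ y) :
    toSch (wittCoord (some (x, y))) = inftySch := by
  refine wittSch_ext fun μ => ?_
  rw [inftySch_schur]
  exact (pairWitt_eq_one_iff x y _).2 (survives_schur_of_pos hy μ)

theorem toSch_wittCoord_none : toSch (wittCoord none) = inftySch := by
  refine wittSch_ext fun μ => ?_
  rw [inftySch_schur]
  exact (nonzeroHom_eq_one_iff _ _).2 fun h => schur_ne_zero μ (congrArg Subtype.val h)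

open Classical in
theorem natSch_schur (x : ℕ) (μ : YoungDiagram) :
    natSch BB x ⟨schur μ, schur_mem_LambdaSch μ⟩ = if 1 ≤ μ.rowLen x then 0 else 1 := by
  refine BB.ext_one ?_
  rw [natSch_eq_one_iff, survives_zero_schur_iff]
  by_cases h : 1 ≤ μ.rowLen x <;> simp [h, BB.zero_ne_one]

end

end BoolWitt

theorem mainTheorem8 :
    Function.Bijective BoolWitt.wittCoord ∧
    (∀ x : ℕ, BoolWitt.toSch (BoolWitt.wittCoord (some (x, 0))) =
      BoolWitt.natSch BoolWitt.BB x) ∧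
    (∀ x y : ℕ, 1 ≤ y → BoolWitt.toSch (BoolWitt.wittCoord (some (x, y))) =
      BoolWitt.inftySch) ∧
    BoolWitt.toSch (BoolWitt.wittCoord none) = BoolWitt.inftySch ∧
    (∀ (x : ℕ) (μ : YoungDiagram),
      BoolWitt.natSch BoolWitt.BB x ⟨BoolWitt.schur μ, BoolWitt.schur_mem_LambdaSch μ⟩ =
        if 1 ≤ μ.rowLen x then 0 else 1) := by
  refine ⟨⟨BoolWitt.wittCoord_injective, BoolWitt.wittCoord_surjective⟩,
    BoolWitt.toSch_pairWitt_zero, fun x _ hy => BoolWitt.toSch_wittCoord_of_pos x hy,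
    BoolWitt.toSch_wittCoord_none, fun x μ => ?_⟩
  rw [BoolWitt.natSch_schur]
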